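/- **Setting.** Let $\Gamma=\{\rho=0\}\subset\mathbb R^3$ be a smooth closed surface, the boundary of a bounded open set $\{\rho<0\}$ with $\rho\in C^\infty(\mathbb R^3)$ and $\nabla\rho\neq0$ on $\Gamma$; let $\nu=\nabla\rho/|\nabla\rho|$ be its outward unit normal and $ds$ its area measure. Let $\widehat T\subset\mathbb R^2$ be a reference element (a compact convex set with non-empty interior). A mesh $\mathcal T_h$ of $\Gamma$ is a finite family of elements $T=F_T(\widehat T)$ that cover $\Gamma$, with $F_T$ smooth on $\widehat T$ and injective on its interior, and with $F_T(\operatorname{int}\widehat T)$ pairwise disjoint; $h_T=\operatorname{diam}T$, $h=\max_T h_T$ and $J_T=|\partial_1F_T\times\partial_2F_T|$. Consider a family of meshes that is shape-regular: there are constants $c>0$ and $C_j$ ($j\ge1$), independent of the mesh and of $T$, with $|D^jF_T|\le C_jh_T^{\,j}$ and $J_T\ge c\,h_T^2$ on $\widehat T$. Let $q\in\mathbb N_0$, let $(\hat x_j,w_j)_j$ be a quadrature rule on $\widehat T$ with $\hat x_j\in\widehat T$, $w_j>0$, exact for all polynomials of total degree $\le q$, and put $Q_\Gamma[\psi]=\sum_T\sum_jw_j\,\psi(F_T(\hat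 x_j))\,J_T(\hat x_j)$. Each $\mathsf B\in\{\mathsf S,\mathsf K,\mathsf K^\top,\mathsf H,\mathsf W\}$ has parameters $(p,s)=(0,0),(1,0),(1,0),(2,1),(2,0)$, respectively, and functions - $\mathsf S$: $\Phi(r)=\cos r$, $\Psi(x,y)=1$; - $\mathsf K$: $\Phi(r)=\cos r+r\sin r$, $\Psi(x,y)=\nu(y)\cdot(x-y)$; - $\mathsf K^\top$: $\Phi(r)=\cos r+r\sin r$, $\Psi(x,y)=\nu(x)\cdot(y-x)$; - $\mathsf H$: $\Phi(r)=\cos r+r\sin r$, $\Psi(x,y)=|x-y|^2\,\nu(y)\cdot\nu(x)$; - $\mathsf W$: $\Phi(r)=(r^2-3)\cos r-3r\sin r$, $\Psi(x,y)=[(x-y)\cdot\nu(y)]\,[(x-y)\cdot\nu(x)]$. Fix $k>0$, $n\in\mathbb N_0$ and $A\in\mathbb R$. For real coefficients $a_1,\dots,a_n$ let $\sigma_p(t)=\operatorname{erf}(t)+\frac2{\sqrt\pi}e^{-t^2}\big(t^{2p}\sum_{\ell=1}^na_\ell t^{2\ell-1}+\pi_p(t)\big)$ with $\pi_0(t)=0$,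 $\pi_1(t)=-t$, $\pi_2(t)=-t-\frac23t^3$, and $$f(y)=\frac{\Phi(k|x-y|)}{|x-y|^{2p+1}}\Psi(x,y)\varphi(y),\qquad f_\delta(y)=\frac{\Phi(k|x-y|)}{|x-y|^{2p+1}}\,\sigma_p\Big(\frac{|x-y|}\delta\Big)\Psi(x,y)\varphi(y),$$ $f_\delta$ being extended continuously to $y=x$. The $C^r(\Gamma)$-norm of $\varphi$ is the infimum, over all $C^r$ extensions $g:\mathbb R^3\to\mathbb C$ of $\varphi|_\Gamma$, of $\max_{j\le r}\max_\Gamma|D^jg|$. **Theorem (Quadrature and discretization error).** 1. *Discretization error bound.* There is a constant $C>0$, depending only on $k$, $\Gamma$, $q$, $\mathsf B$, $n$, $A$, the quadrature rule and the mesh family (not on $h$, $\delta$, $x$, $\varphi$ or the particular $a_\ell$), such that for all coefficients with $|a_\ell|\le A$, all $\varphi\in C^{q+1}(\Gamma)$, all $x\in\Gamma$ and all $\delta\in(0,1)$, the function $f_\delta$ is integrable on $\Gamma$, and for every mesh of the family with $h\le\delta$, $$\Big|\int_\Gamma f_\delta\,ds-Q_\Gamma[f_\delta]\Big|\le C\,\|\varphi\|_{C^{q+1}(\Gamma)}\,h^{q+1}\times\begin{cases}\delta^{-(q+1)},&p=s,\\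 \delta^{-(q+2(p-s))},&p>s.\end{cases}$$ 2. *Optimal regularization parameter.* Let $m\ge1$ be an integer, let the coefficients $a_\ell=a_\ell(\delta)$ be functions of $\delta$ with $|a_\ell(\delta)|\le A$ for $\delta\in(0,1)$, and let $\varphi\in C^{q+1}(\Gamma)$ and $x\in\Gamma$. Suppose that the Hadamard finite part $\mathsf B[\varphi](x)=\mathrm{p.f.}\int_\Gamma f\,ds$ exists, that is, for some $c_0\in\mathbb C$ it is the limit of $\int_{\Gamma\cap\{|x-y|\ge\varepsilon\}}f\,ds-c_0/\varepsilon$ as $\varepsilon\to0^+$, and that the regularization error $E_r=\mathsf B[\varphi](x)-\int_\Gamma f_\delta\,ds$ is $O(\delta^m)$ as $\delta\to0^+$. Let $E_d=\int_\Gamma f_\delta\,ds-Q_\Gamma[f_\delta]$, and set $$\mu^\star=\begin{cases}\dfrac{q+1}{q+1+m},&p=s,\\[2mm]\dfrac{q+1}{q+2(p-s)+m},&p>s,\end{cases}\qquad o^\star=\mu^\star m .$$ Then for every $c>0$, with $\delta=c\,h^{\mu^\star}$, as $h\to0$ along the mesh family, $E_r=O(h^{o^\star})$, $E_d=O(h^{o^\star})$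 and the total error satisfies $E=E_r+E_d=O(h^{o^\star})$. 3. *Balance and limits.* For every integer $m\ge1$ the two orders agree: $o^\star=\mu^\star m=q+1-e\,\mu^\star$ with $e=q+1$ if $p=s$ and $e=q+2(p-s)$ if $p>s$. Moreover $o^\star\to q+1$ as $m\to\infty$ for fixed $q$, and $o^\star\to m$ as $q\to\infty$ for every fixed integer $m\ge0$. -/

import Mathlib

open MeasureTheory Filter Topology
open scoped ContDiff Matrix

noncomputable section

namespace KernelReg

/-- The ambient Euclidean space `ℝ³`. -/
abbrev E3 := EuclideanSpace ℝ (Fin 3)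

/-- The Euclidean plane `ℝ²` that contains the reference element. -/
abbrev E2 := EuclideanSpace ℝ (Fin 2)

/-! ### The surface -/

/-- A smooth closed surface in `ℝ³`: the boundary `Γ = {ρ = 0}` of the bounded open set
`{ρ < 0}`, where `ρ` is a smooth defining function with non-vanishing gradient on `Γ`. -/
structure ClosedSurface where
  defFun : E3 → ℝ
  smooth : ContDiff ℝ ∞ defFun
  regular : ∀ y, defFun y = 0 → gradient defFun y ≠ 0
  bounded : Bornology.IsBounded {y | defFun y ≤ 0}

namespace ClosedSurface

/-- The point set `Γ`. -/
def carrier (Γ : ClosedSurface) : Set E3 := {y | Γ.defFun y = 0}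

/-- The outward unit normal `ν` (used on `Γ` only). -/
def normal (Γ : ClosedSurface) (y : E3) : E3 :=
  ‖gradient Γ.defFun y‖⁻¹ • gradient Γ.defFun y

/-- The surface area measure `ds`: the two-dimensional Hausdorff measure, normalized so that it
agrees with Lebesgue measure on planes, restricted to `Γ`. -/
def area (Γ : ClosedSurface) : Measure E3 := (μHE[2] : Measure E3).restrict Γ.carrier

/-- `φ ∈ C^r(Γ)`: on `Γ` the function `φ` coincides with a `C^r` function on `ℝ³`. Only the values
of `φ` on `Γ` matter. -/
def IsCk (Γ : ClosedSurface) (r : ℕ) (φ : E3 → ℂ) : Prop :=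
  ∃ g : E3 → ℂ, ContDiff ℝ r g ∧ Set.EqOn g φ Γ.carrier

/-- The norm of `C^r(Γ)`: the infimum, over all `C^r` extensions `g` of `φ|_Γ`, of the maximum
over `Γ` of the derivatives of `g` of order at most `r`. -/
def ckNorm (Γ : ClosedSurface) (r : ℕ) (φ : E3 → ℂ) : ℝ :=
  sInf {M : ℝ | 0 ≤ M ∧ ∃ g : E3 → ℂ, ContDiff ℝ r g ∧ Set.EqOn g φ Γ.carrier ∧
    ∀ j ≤ r, ∀ y ∈ Γ.carrier, ‖iteratedFDeriv ℝ j g y‖ ≤ M}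

/-- `L = p.f. ∫_Γ g ds`, the Hadamard finite part at the point `x` of an integral whose truncation
to `|x - y| ≥ ε` diverges at most like `c / ε` as `ε → 0+`: the limit that remains when the
divergent term is dropped. For an integrable `g` this is the integral of `g` (with `c = 0`). -/
def HasFinitePart (Γ : ClosedSurface) (x : E3) (g : E3 → ℂ) (L : ℂ) : Prop :=
  ∃ c : ℂ, Tendsto (fun ε : ℝ => (∫ y in {y : E3 | ε ≤ ‖x - y‖}, g y ∂Γ.area) - c / (ε : ℂ))
    (𝓝[>] 0) (𝓝 L)

end ClosedSurface

/-! ### Meshes and quadrature rules -/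

/-- A reference element, such as the unit triangle or the unit square. -/
structure ReferenceElement where
  carrier : Set E2
  compact : IsCompact carrier
  convex : Convex ℝ carrier
  interior_nonempty : (interior carrier).Nonempty

/-- The surface Jacobian `J = |∂₁F × ∂₂F|` of a parametrization `F` of a surface element
(with derivatives within the reference element). -/
def surfaceJacobian (That : ReferenceElement) (F : E2 → E3) (z : E2) : ℝ :=
  ‖WithLp.toLp 2
    ((fderivWithin ℝ F That.carrier z (EuclideanSpace.single 0 1)).ofLp ⨯₃
      (fderivWithin ℝ F That.carrier z (EuclideanSpace.single 1 1)).ofLp)‖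

/-- A mesh `𝒯_h` of `Γ` by finitely many non-overlapping curved elements `T = F_T(T̂)`. -/
structure SurfaceMesh (Γ : ClosedSurface) (That : ReferenceElement) where
  card : ℕ
  param : Fin card → E2 → E3
  smooth : ∀ T, ContDiffOn ℝ ∞ (param T) That.carrier
  injOn : ∀ T, Set.InjOn (param T) (interior That.carrier)
  covers : ⋃ T, param T '' That.carrier = Γ.carrier
  nonoverlapping : ∀ T T', T ≠ T' →
    Disjoint (param T '' interior That.carrier) (param T' '' interior That.carrier)

namespace SurfaceMesh

variable {Γ : ClosedSurface} {That : ReferenceElement}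

/-- The diameter `h_T` of the element `T`. -/
def elementDiam (M : SurfaceMesh Γ That) (T : Fin M.card) : ℝ :=
  Metric.diam (M.param T '' That.carrier)

/-- The mesh size `h = max_T diam T`. -/
def size (M : SurfaceMesh Γ That) : ℝ := ⨆ T, M.elementDiam T

end SurfaceMesh

/-- Shape regularity of a family of curved meshes: the derivatives of order `j` of the
parametrizations are `O(h_T^j)` and the surface Jacobians are bounded below by a multiple of
`h_T²`, uniformly over all elements of all meshes. -/
def ShapeRegular {Γ : ClosedSurface} {That : ReferenceElement} {ι : Type*}
    (mesh : ι → SurfaceMesh Γ That) : Prop :=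
  (∀ j : ℕ, 1 ≤ j → ∃ C : ℝ, ∀ (i : ι) (T : Fin (mesh i).card), ∀ z ∈ That.carrier,
    ‖iteratedFDerivWithin ℝ j ((mesh i).param T) That.carrier z‖
      ≤ C * (mesh i).elementDiam T ^ j) ∧
  (∃ c : ℝ, 0 < c ∧ ∀ (i : ι) (T : Fin (mesh i).card), ∀ z ∈ That.carrier,
    c * (mesh i).elementDiam T ^ 2 ≤ surfaceJacobian That ((mesh i).param T) z)

/-- A quadrature rule on the reference element with positive weights and degree of exactness
`q`. -/
structure QuadratureRule (That : ReferenceElement) (q : ℕ) where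
  card : ℕ
  node : Fin card → E2
  weight : Fin card → ℝ
  node_mem : ∀ j, node j ∈ That.carrier
  weight_pos : ∀ j, 0 < weight j
  exact : ∀ P : MvPolynomial (Fin 2) ℝ, P.totalDegree ≤ q →
    ∑ j, weight j * MvPolynomial.eval (node j).ofLp P
      = ∫ z in That.carrier, MvPolynomial.eval z.ofLp P

/-- The composite quadrature rule
`Q_Γ[ψ] = ∑_T ∑_j w_j ψ(F_T(x̂_j)) J_T(x̂_j)`. -/
def compositeQuadrature {Γ : ClosedSurface} {That : ReferenceElement} {q : ℕ}
    (Q : QuadratureRule That q) (M : SurfaceMesh Γ That) (ψ : E3 → ℂ) : ℂ :=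
  ∑ T, ∑ j, ((Q.weight j * surfaceJacobian That (M.param T) (Q.node j) : ℝ) : ℂ)
    * ψ (M.param T (Q.node j))

/-! ### The regularizing functions -/

/-- The error function. -/
def erf (t : ℝ) : ℝ := 2 / √Real.pi * ∫ τ in (0 : ℝ)..t, Real.exp (-τ ^ 2)

/-- The polynomial `P_p(t) = t^{2p} ∑_{ℓ=1}^n a_ℓ t^{2ℓ-1} + {0, -t, -t - (2/3) t³}` for
`p = 0, 1, 2`. -/
def regPoly (p n : ℕ) (a : ℕ → ℝ) (t : ℝ) : ℝ :=
  t ^ (2 * p) * ∑ ℓ ∈ Finset.Icc 1 n, a ℓ * t ^ (2 * ℓ - 1)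
    + (match p with
      | 0 => 0
      | 1 => -t
      | _ => -t - 2 / 3 * t ^ 3)

/-- The regularizing function `σ_p(t) = erf t + (2/√π) e^{-t²} P_p(t)`. -/
def sigma (p n : ℕ) (a : ℕ → ℝ) (t : ℝ) : ℝ :=
  erf t + 2 / √Real.pi * Real.exp (-t ^ 2) * regPoly p n a t

/-- The limit of `σ_p(t) / t^{2p+1}` as `t → 0`, for `p = 0, 1, 2`. -/
def sigmaLimit (p n : ℕ) (a : ℕ → ℝ) : ℝ :=
  2 / √Real.pi * ((match p with
      | 0 => 1
      | 1 => 2 / 3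
      | _ => 4 / 15) + if 1 ≤ n then a 1 else 0)

/-- The radial factor `σ_p(r/δ) / r^{2p+1}`, extended continuously to `r = 0`. -/
def sigmaRatio (p n : ℕ) (a : ℕ → ℝ) (δ r : ℝ) : ℝ :=
  if r = 0 then sigmaLimit p n a / δ ^ (2 * p + 1) else sigma p n a (r / δ) / r ^ (2 * p + 1)

/-! ### The boundary integral operators -/

/-- The operators: single layer, double layer, adjoint double layer, and the two parts
`H` (hypersingular) and `W` (weakly singular) of the hypersingular operator. -/
inductive LayerOp
  | S
  | K
  | KT
  | H
  | W

namespace LayerOp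

/-- The singularity parameter `p`. -/
def p : LayerOp → ℕ
  | S => 0
  | K => 1
  | KT => 1
  | H => 2
  | W => 2

/-- The parameter `s`. -/
def s : LayerOp → ℕ
  | S => 0
  | K => 0
  | KT => 0
  | H => 1
  | W => 0

/-- The even function `Φ`. -/
def Phi : LayerOp → ℝ → ℝ
  | S, r => Real.cos r
  | K, r => Real.cos r + r * Real.sin r
  | KT, r => Real.cos r + r * Real.sin r
  | H, r => Real.cos r + r * Real.sin r
  | W, r => (r ^ 2 - 3) * Real.cos r - 3 * r * Real.sin r

/-- The smooth function `Ψ` on `Γ × Γ`. -/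
def Psi (Γ : ClosedSurface) : LayerOp → E3 → E3 → ℝ
  | S, _, _ => 1
  | K, x, y => inner ℝ (Γ.normal y) (x - y)
  | KT, x, y => inner ℝ (Γ.normal x) (y - x)
  | H, x, y => inner ℝ (x - y) (x - y) * inner ℝ (Γ.normal y) (Γ.normal x)
  | W, x, y => inner ℝ (x - y) (Γ.normal y) * inner ℝ (x - y) (Γ.normal x)

/-- The exponent `e` of `δ^{-e}` in the discretization error bound: `q + 1` if `p = s`, and
`q + 2 (p - s)` if `p > s`. -/
def deltaExponent (B : LayerOp) (q : ℕ) : ℕ :=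
  if B.p = B.s then q + 1 else q + 2 * (B.p - B.s)

/-- The optimal exponent `μ⋆(p, s)`. -/
def muStar (B : LayerOp) (q m : ℕ) : ℝ :=
  if B.p = B.s then ((q : ℝ) + 1) / (q + 1 + m)
  else ((q : ℝ) + 1) / (q + 2 * ((B.p : ℝ) - B.s) + m)

/-- The overall convergence rate `𝔬⋆(p, s) = μ⋆(p, s) 𝔪`. -/
def oStar (B : LayerOp) (q m : ℕ) : ℝ := B.muStar q m * m

/-- The singular integrand
`f(y) = Φ(k|x-y|) / |x-y|^{2p+1} · Ψ(x,y) φ(y)` of `B[φ](x)`. -/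
def singularIntegrand (Γ : ClosedSurface) (B : LayerOp) (k : ℝ) (φ : E3 → ℂ) (x y : E3) : ℂ :=
  ((B.Phi (k * ‖x - y‖) / ‖x - y‖ ^ (2 * B.p + 1) * B.Psi Γ x y : ℝ) : ℂ) * φ y

/-- The regularized integrand
`f_δ(y) = Φ(k|x-y|) / |x-y|^{2p+1} · σ_p(|x-y|/δ) Ψ(x,y) φ(y)`, extended continuously to
`y = x`. -/
def regularizedIntegrand (Γ : ClosedSurface) (B : LayerOp) (k : ℝ) (n : ℕ) (a : ℕ → ℝ) (δ : ℝ)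
    (φ : E3 → ℂ) (x y : E3) : ℂ :=
  ((B.Phi (k * ‖x - y‖) * sigmaRatio B.p n a δ ‖x - y‖ * B.Psi Γ x y : ℝ) : ℂ) * φ y

end LayerOp

/-- The regularization error `E_r = B[φ](x) - ∫_Γ f_δ ds`, where `L` stands for the value
`B[φ](x) = p.f. ∫_Γ f ds`. -/
def regularizationError (Γ : ClosedSurface) (B : LayerOp) (k : ℝ) (n : ℕ) (a : ℕ → ℝ) (δ : ℝ)
    (φ : E3 → ℂ) (x : E3) (L : ℂ) : ℂ :=
  L - ∫ y, B.regularizedIntegrand Γ k n a δ φ x y ∂Γ.area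

/-- The discretization error `E_d = ∫_Γ f_δ ds - Q_Γ[f_δ]`. -/
def discretizationError {Γ : ClosedSurface} {That : ReferenceElement} {q : ℕ}
    (Q : QuadratureRule That q) (M : SurfaceMesh Γ That) (B : LayerOp) (k : ℝ) (n : ℕ) (a : ℕ → ℝ)
    (δ : ℝ) (φ : E3 → ℂ) (x : E3) : ℂ :=
  (∫ y, B.regularizedIntegrand Γ k n a δ φ x y ∂Γ.area)
    - compositeQuadrature Q M (B.regularizedIntegrand Γ k n a δ φ x)

end KernelReg

end

open KernelReg

/-! Put `ρ(y) = δ + |y - x|`. Pulled back to the reference element and multiplied by the Jacobian,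
the integrand has size `h_T² ρ^{2s-2p-1} ‖φ‖`, and each derivative costs a constant times `h_T/ρ`. A
rule of exactness `q` sees only the Taylor remainder of order `q + 1`, so the error on `T` is at
most a constant times `‖φ‖ h_T^{q+1} · h_T² ρ^{2s-2p-2-q}`. Of the negative power of `ρ`, a factor
`ρ⁻³` is kept and the rest is bounded by a power of `δ ≤ ρ` (`ErrorData.weight_le`). Since `h_T ≤
δ`, the distance `ρ` at most doubles across an element, so `h_T² ρ⁻³` is controlled by the integral
of `ρ⁻³` over `T`. Summing over `T` gives `∫_Γ ρ⁻³ ds = O(1/δ)`, by dyadic shells and the quadratic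
area growth of `Γ`.

The derivative count rests on two facts. First, `σ_p(r/δ)/r^{2p+1} = δ^{-(2p+1)} S(r²/δ²)` with `S`
smooth and `S^{(i)}(w) = O((1+w)^{-(i+p+1/2)})`: the polynomials `π_p` are exactly what turns `erf`
into `t^{2p+1}` times a Gauss moment, whose derivatives are again moments. Second, `Φ(k|y|)` is
smooth across the origin. `JetFrame.Bounded` records bounds of this scaled type and is stable under
products and composition, so that each factor is treated separately.

The surface integral is tied to the mesh by an area formula for `μHE[2]`, obtained by comparing a
parametrization with its derivative locally up to a factor `K` and letting `K → 1`.

For the optimal parameter, `δ^m` and `h^{q+1} δ^{-e}` have equal order when `μ⋆ (e + m) = q + 1`. As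
`μ⋆ < 1`, the condition `h ≤ δ` holds for small `h`. -/

namespace KernelReg

/-! ### Area formula for injectively parametrized surfaces -/

section HausdorffComparison

variable {X Y Z : Type*} [MetricSpace Y] [MeasurableSpace Y] [BorelSpace Y]
  [MetricSpace Z] [MeasurableSpace Z] [BorelSpace Z]

/-- On `s`, equal values of `g` force equal values of `f`, so `f` factors through `g` by a
`K`-Lipschitz map on `g '' s`. Neither map need be injective, which allows `g` to be a projection or
a linearization. -/
theorem hausdorffMeasure_image_le_of_dist_le {f : X → Y} {g : X → Z} {s : Set X} {K : NNReal}
    (d : ℝ) (hd : 0 ≤ d) (h : ∀ z ∈ s, ∀ w ∈ s, dist (f z) (f w) ≤ K * dist (g z) (g w)) :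
    μH[d] (f '' s) ≤ (K : ENNReal) ^ d * μH[d] (g '' s) := by
  rcases s.eq_empty_or_nonempty with rfl | ⟨z₀, hz₀⟩
  · simp
  have : Nonempty X := ⟨z₀⟩
  have hinv : ∀ z ∈ s, Function.invFunOn g s (g z) ∈ s ∧ g (Function.invFunOn g s (g z)) = g z :=
    fun z hz => Function.invFunOn_pos ⟨z, hz, rfl⟩
  have hEq : ∀ z ∈ s, f (Function.invFunOn g s (g z)) = f z := by
    intro z hz
    obtain ⟨h1, h2⟩ := hinv z hz
    have := h _ h1 z hz
    rw [h2, dist_self, mul_zero] at this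
    exact dist_le_zero.1 this
  have hL : LipschitzOnWith K (f ∘ Function.invFunOn g s) (g '' s) := by
    refine LipschitzOnWith.of_dist_le_mul ?_
    rintro _ ⟨z, hz, rfl⟩ _ ⟨w, hw, rfl⟩
    simp only [Function.comp_apply, hEq z hz, hEq w hw]
    exact h z hz w hw
  have himg : (f ∘ Function.invFunOn g s) '' (g '' s) = f '' s := by
    rw [Set.image_image]
    exact Set.image_congr hEq
  rw [← himg]
  exact hL.hausdorffMeasure_image_le hd

theorem euclideanHausdorffMeasure_image_le_of_dist_le {f : X → Y} {g : X → Z} {s : Set X}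
    {K : NNReal} (d : ℕ) (h : ∀ z ∈ s, ∀ w ∈ s, dist (f z) (f w) ≤ K * dist (g z) (g w)) :
    μHE[d] (f '' s) ≤ (K : ENNReal) ^ d * μHE[d] (g '' s) := by
  simp_rw [Measure.euclideanHausdorffMeasure_def, Measure.smul_apply, Measure.nnreal_smul_coe_apply]
  rw [mul_left_comm]
  gcongr
  simpa using hausdorffMeasure_image_le_of_dist_le (d : ℝ) (by positivity) h

end HausdorffComparison

/-- Comparison of measures is a local property. -/
theorem measure_le_of_locally_le {X : Type*} [TopologicalSpace X] [SecondCountableTopology X]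
    [MeasurableSpace X] [OpensMeasurableSpace X] {μ ν : Measure X} {c : ENNReal}
    (h : ∀ z, ∃ V ∈ 𝓝 z, ∀ s ⊆ V, MeasurableSet s → μ s ≤ c * ν s)
    {s : Set X} (hs : MeasurableSet s) : μ s ≤ c * ν s := by
  choose V hV hle using h
  obtain ⟨t, ht, hcov⟩ := TopologicalSpace.countable_cover_nhds
    (fun z => interior_mem_nhds.2 (hV z))
  rcases t.eq_empty_or_nonempty with rfl | hne
  · have : s = ∅ := by
      apply Set.eq_empty_of_subset_empty
      intro z _
      have : z ∈ (Set.univ : Set X) := trivial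
      rw [← hcov] at this
      simp at this
    simp [this]
  obtain ⟨e, rfl⟩ := ht.exists_eq_range hne
  let D := disjointed (fun n => interior (V (e n)))
  have hD : ∀ n, MeasurableSet (D n) :=
    MeasurableSet.disjointed (fun n => isOpen_interior.measurableSet)
  have hU : ⋃ n, D n = Set.univ := by
    rw [iUnion_disjointed, ← hcov, Set.biUnion_range]
  have hsU : s = ⋃ n, s ∩ D n := by rw [← Set.inter_iUnion, hU, Set.inter_univ]
  have hdis : Pairwise (Function.onFun Disjoint fun n => s ∩ D n) := fun i j hij =>
    (disjoint_disjointed _ hij).mono Set.inter_subset_right Set.inter_subset_right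
  have hsum : ∀ m : Measure X, m s = ∑' n, m (s ∩ D n) := by
    intro m
    conv_lhs => rw [hsU]
    exact measure_iUnion hdis (fun n => hs.inter (hD n))
  rw [hsum μ, hsum ν, ← ENNReal.tsum_mul_left]
  refine ENNReal.tsum_le_tsum fun n => hle (e n) _ ?_ (hs.inter (hD n))
  exact Set.inter_subset_right.trans ((disjointed_subset _ n).trans interior_subset)

theorem le_of_forall_one_lt_pow_mul_le {a b : ENNReal} (n : ℕ)
    (h : ∀ K : NNReal, 1 < K → a ≤ (K : ENNReal) ^ n * b) : a ≤ b := by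
  have ht : Tendsto (fun K : NNReal => (K : ENNReal) ^ n * b) (𝓝[>] 1) (𝓝 (1 * b)) := by
    refine ENNReal.Tendsto.mul_const ?_ (Or.inl one_ne_zero)
    have h1 : Tendsto (fun K : NNReal => ((K ^ n : NNReal) : ENNReal)) (𝓝[>] 1)
        (𝓝 (((1 : NNReal) ^ n : NNReal) : ENNReal)) :=
      ENNReal.tendsto_coe.2 (((continuous_pow n).tendsto _).mono_left nhdsWithin_le_nhds)
    simpa using h1
  rw [one_mul] at ht
  have : (𝓝[>] (1 : NNReal)).NeBot := nhdsGT_neBot_of_exists_gt ⟨2, by norm_num⟩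
  exact ge_of_tendsto ht (by filter_upwards [self_mem_nhdsWithin] with K hK using h K hK)

/-- The area factor `|A e₁ × A e₂|` of a linear map from the plane to space. -/
noncomputable def areaFactor (A : E2 →L[ℝ] E3) : ℝ :=
  ‖WithLp.toLp 2 ((A (EuclideanSpace.single 0 1)).ofLp ⨯₃ (A (EuclideanSpace.single 1 1)).ofLp)‖

/-- Lagrange's identity: `|u × v|² = |u|²|v|² - (u·v)²` is the Gram determinant of the two image
vectors. -/
theorem areaFactor_eq_normDet (A : E2 →L[ℝ] E3) :
    areaFactor A = (A : E2 →ₗ[ℝ] E3).normDet := by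
  have h := (A : E2 →ₗ[ℝ] E3).normDet_sq_eq_det_gram (EuclideanSpace.basisFun (Fin 2) ℝ)
  have h0 : 0 ≤ (A : E2 →ₗ[ℝ] E3).normDet := LinearMap.normDet_nonneg _
  refine (sq_eq_sq₀ (norm_nonneg _) h0).1 ?_
  have h' : ((A : E2 →ₗ[ℝ] E3).normDet) ^ 2 = _ := h
  rw [h', Matrix.det_fin_two]
  rw [EuclideanSpace.norm_sq_eq]
  simp only [Matrix.gram_apply, EuclideanSpace.basisFun_apply, PiLp.inner_apply, cross_apply,
    Fin.sum_univ_three, Real.norm_eq_abs, sq_abs]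
  simp
  ring

theorem continuous_areaFactor : Continuous areaFactor := by
  unfold areaFactor
  simp only [cross_apply]
  refine continuous_norm.comp ((PiLp.continuous_toLp 2 _).comp (continuous_pi fun i => ?_))
  have h : ∀ j k, Continuous fun A : E2 →L[ℝ] E3 => (A (EuclideanSpace.single j 1)).ofLp k :=
    fun j k => (EuclideanSpace.proj (𝕜 := ℝ) k).continuous.comp
      (ContinuousLinearMap.apply ℝ E3 (EuclideanSpace.single j 1)).continuous
  fin_cases i <;> simp <;> exact ((h _ _).mul (h _ _)).sub ((h _ _).mul (h _ _))

theorem euclideanHausdorffMeasure_image_eq_areaFactor_mul (A : E2 →L[ℝ] E3) (s : Set E2) :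
    μHE[2] (A '' s) = ENNReal.ofReal (areaFactor A) * volume s := by
  have := (A : E2 →ₗ[ℝ] E3).euclideanHausdorffMeasure_image_eq_normDet_mul_volume s
  rw [areaFactor_eq_normDet]
  simpa using this

/-- A non-zero area factor makes the derivative injective, hence bounded below. Strict
differentiability then makes the linearization error a small fraction of `|A z - A w|`, and
continuity of the derivative keeps the area factor nearly constant. -/
theorem exists_nhds_bilipschitz {F : E2 → E3} {z₀ : E2} (hF : ContDiffAt ℝ 1 F z₀)
    (hJ : 0 < areaFactor (fderiv ℝ F z₀)) {K : NNReal} (hK : 1 < K) :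
    ∃ V ∈ 𝓝 z₀, (∀ z ∈ V, ∀ w ∈ V,
      dist (F z) (F w) ≤ K * dist (fderiv ℝ F z₀ z) (fderiv ℝ F z₀ w) ∧
      dist (fderiv ℝ F z₀ z) (fderiv ℝ F z₀ w) ≤ K * dist (F z) (F w)) ∧
      ∀ z ∈ V, areaFactor (fderiv ℝ F z) ≤ K * areaFactor (fderiv ℝ F z₀) ∧
        areaFactor (fderiv ℝ F z₀) ≤ K * areaFactor (fderiv ℝ F z) := by
  set A := fderiv ℝ F z₀ with hA
  have hK' : (1 : ℝ) < K := by exact_mod_cast hK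
  have hinj : (A : E2 →ₗ[ℝ] E3).ker = ⊥ := by
    by_contra hne
    have := ((A : E2 →ₗ[ℝ] E3).normDet_eq_zero_tfae.out 1 0).1 hne
    rw [← areaFactor_eq_normDet] at this
    exact hJ.ne' this
  obtain ⟨c, hc, hanti⟩ := (A : E2 →ₗ[ℝ] E3).exists_antilipschitzWith hinj
  have hc' : (0 : ℝ) < c := by exact_mod_cast hc
  -- The choice `ε = (K - 1)/K` gives `K(1 - ε) = 1` exactly, and `1 + ε ≤ K` because `K > 1`.
  obtain ⟨ε, hε, hε1, hε2⟩ : ∃ ε : ℝ, 0 < ε ∧ 1 + ε ≤ K ∧ 1 ≤ K * (1 - ε) := by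
    refine ⟨(K - 1) / K, by positivity [sub_pos.2 hK'], ?_, ?_⟩
    · have : ((K : ℝ) - 1) / K ≤ K - 1 := div_le_self (by linarith) hK'.le
      linarith
    · field_simp; linarith
  have hstrict := (hF.hasStrictFDerivAt one_ne_zero).isLittleO.def (c := ε / c) (by positivity)
  rw [nhds_prod_eq] at hstrict
  obtain ⟨V, hV, hVs⟩ := (eventually_prod_self_iff
    (r := fun z w => ‖F z - F w - fderiv ℝ F z₀ (z - w)‖ ≤ ε / c * ‖z - w‖)).1 hstrict
  have hcont : ContinuousAt (fun z => areaFactor (fderiv ℝ F z)) z₀ :=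
    continuous_areaFactor.continuousAt.comp (hF.fderiv_right (m := 0) (by norm_num)).continuousAt
  have h1 : ∀ᶠ z in 𝓝 z₀, areaFactor (fderiv ℝ F z) < K * areaFactor A :=
    hcont.eventually_lt_const (by nlinarith)
  have h2 : ∀ᶠ z in 𝓝 z₀, areaFactor A / K < areaFactor (fderiv ℝ F z) :=
    hcont.eventually_const_lt (div_lt_self hJ hK')
  refine ⟨V ∩ {z | _ ∧ _}, inter_mem hV (h1.and h2), ?_, ?_⟩
  · rintro z ⟨hz, -⟩ w ⟨hw, -⟩
    have hs := hVs z hz w hw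
    have ha : dist z w ≤ c * dist (A z) (A w) := hanti.le_mul_dist z w
    rw [dist_eq_norm] at ha
    have hd : ‖F z - F w - A (z - w)‖ ≤ ε * dist (A z) (A w) :=
      hs.trans (by
        calc ε / c * ‖z - w‖ ≤ ε / c * (c * dist (A z) (A w)) := by gcongr
          _ = _ := by field_simp)
    rw [map_sub] at hd
    have hn1 : ‖F z - F w‖ ≤ ‖F z - F w - (A z - A w)‖ + ‖A z - A w‖ := by
      simpa using norm_add_le (F z - F w - (A z - A w)) (A z - A w)
    have hn2 : ‖A z - A w‖ ≤ ‖F z - F w - (A z - A w)‖ + ‖F z - F w‖ := by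
      have := norm_sub_le (F z - F w) (F z - F w - (A z - A w))
      simp only [sub_sub_cancel] at this
      linarith
    rw [dist_eq_norm] at hd
    rw [dist_eq_norm, dist_eq_norm]
    have hpos := norm_nonneg (A z - A w)
    constructor
    · nlinarith
    · have : (1 - ε) * ‖A z - A w‖ ≤ ‖F z - F w‖ := by linarith
      nlinarith [norm_nonneg (F z - F w), NNReal.coe_nonneg K]
  · rintro z ⟨-, hz1, hz2⟩
    refine ⟨hz1.le, ?_⟩
    rw [div_lt_iff₀ (by positivity)] at hz2
    linarith

/-- **Area formula** for an injective parametrization: the two-dimensional Hausdorff measure of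
the image is the integral of the area factor. -/
theorem euclideanHausdorffMeasure_image_eq_lintegral {F : E2 → E3} {U : Set E2} (hU : IsOpen U)
    (hF : ContDiffOn ℝ 1 F U) (hinj : Set.InjOn F U)
    (hJ : ∀ z ∈ U, 0 < areaFactor (fderiv ℝ F z)) {s : Set E2} (hs : MeasurableSet s)
    (hsU : s ⊆ U) :
    μHE[2] (F '' s) = ∫⁻ z in s, ENNReal.ofReal (areaFactor (fderiv ℝ F z)) := by
  have hemb : MeasurableEmbedding (U.domRestrict F) :=
    hF.continuousOn.measurableEmbedding hU.measurableSet hinj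
  have hembv : MeasurableEmbedding (Subtype.val : U → E2) :=
    MeasurableEmbedding.subtype_coe hU.measurableSet
  -- Both sides become measures on the subtype `U`, so that a comparison near each point of `U`
  -- suffices.
  let ν₁ : Measure U := (μHE[2] : Measure E3).comap (U.domRestrict F)
  let ν₂ : Measure U := (volume.withDensity
    fun z => ENNReal.ofReal (areaFactor (fderiv ℝ F z))).comap Subtype.val
  have e₁ : ∀ t : Set U, ν₁ t = μHE[2] (F '' (Subtype.val '' t)) := by
    intro t
    rw [hemb.comap_apply, Set.image_image]
    rfl
  have e₂ : ∀ t : Set U, MeasurableSet t →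
      ν₂ t = ∫⁻ z in Subtype.val '' t, ENNReal.ofReal (areaFactor (fderiv ℝ F z)) := by
    intro t ht
    rw [hembv.comap_apply, withDensity_apply _ (hembv.measurableSet_image.2 ht)]
  -- The exponent 3 consists of `K²` for replacing `F` by its derivative in a two-dimensional
  -- measure and `K` for freezing the area factor.
  have key : ∀ K : NNReal, 1 < K → ∀ z : U, ∃ V ∈ 𝓝 z, ∀ t ⊆ V, MeasurableSet t →
      ν₁ t ≤ (K : ENNReal) ^ 3 * ν₂ t ∧ ν₂ t ≤ (K : ENNReal) ^ 3 * ν₁ t := by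
    intro K hK z
    obtain ⟨V, hV, hb, hj⟩ := exists_nhds_bilipschitz
      (hF.contDiffAt (hU.mem_nhds z.2)) (hJ z z.2) hK
    refine ⟨Subtype.val ⁻¹' V, continuous_subtype_val.continuousAt.preimage_mem_nhds hV,
      fun t htV ht => ?_⟩
    rw [e₁, e₂ t ht]
    set T : Set E2 := Subtype.val '' t
    have hTm : MeasurableSet T := hembv.measurableSet_image.2 ht
    have hTV : T ⊆ V := by rintro _ ⟨w, hw, rfl⟩; exact htV hw
    set A := fderiv ℝ F z
    have hA := euclideanHausdorffMeasure_image_eq_areaFactor_mul A T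
    have c₁ : μHE[2] (F '' T) ≤ (K : ENNReal) ^ 2 * μHE[2] (A '' T) :=
      euclideanHausdorffMeasure_image_le_of_dist_le 2
        fun z hz w hw => (hb z (hTV hz) w (hTV hw)).1
    have c₂ : μHE[2] (A '' T) ≤ (K : ENNReal) ^ 2 * μHE[2] (F '' T) :=
      euclideanHausdorffMeasure_image_le_of_dist_le 2
        fun z hz w hw => (hb z (hTV hz) w (hTV hw)).2
    have hconst : ∀ a : ENNReal, ∫⁻ _ in T, a = a * volume T := fun a => by simp
    have hof : ∀ a b : ℝ, a ≤ K * b → ENNReal.ofReal a ≤ K * ENNReal.ofReal b := by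
      intro a b h
      rw [← ENNReal.ofReal_coe_nnreal, ← ENNReal.ofReal_mul K.coe_nonneg]
      exact ENNReal.ofReal_le_ofReal h
    have c₃ : ENNReal.ofReal (areaFactor A) * volume T
        ≤ K * ∫⁻ z in T, ENNReal.ofReal (areaFactor (fderiv ℝ F z)) := by
      rw [← hconst, ← lintegral_const_mul' _ _ ENNReal.coe_ne_top]
      exact setLIntegral_mono' hTm fun w hw => hof _ _ (hj w (hTV hw)).2
    have c₄ : ∫⁻ z in T, ENNReal.ofReal (areaFactor (fderiv ℝ F z))
        ≤ K * (ENNReal.ofReal (areaFactor A) * volume T) := by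
      rw [← mul_assoc, ← hconst]
      exact setLIntegral_mono' hTm fun w hw => hof _ _ (hj w (hTV hw)).1
    rw [hA] at c₁ c₂
    constructor
    · calc _ ≤ _ := c₁
        _ ≤ (K : ENNReal) ^ 2 * (K * _) := by gcongr
        _ = _ := by ring
    · calc _ ≤ _ := c₄
        _ ≤ (K : ENNReal) * ((K : ENNReal) ^ 2 * _) := by gcongr
        _ = _ := by ring
  have hle : ∀ t : Set U, MeasurableSet t → ν₁ t = ν₂ t := by
    intro t ht
    refine le_antisymm (le_of_forall_one_lt_pow_mul_le 3 fun K hK => ?_)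
      (le_of_forall_one_lt_pow_mul_le 3 fun K hK => ?_)
    · exact measure_le_of_locally_le (fun z => by
        obtain ⟨V, hV, h⟩ := key K hK z
        exact ⟨V, hV, fun t h1 h2 => (h t h1 h2).1⟩) ht
    · exact measure_le_of_locally_le (fun z => by
        obtain ⟨V, hV, h⟩ := key K hK z
        exact ⟨V, hV, fun t h1 h2 => (h t h1 h2).2⟩) ht
  have hpre : Subtype.val '' (Subtype.val ⁻¹' s : Set U) = s := by
    rw [Subtype.image_preimage_coe, Set.inter_eq_right.2 hsU]
  have := hle (Subtype.val ⁻¹' s) (measurable_subtype_coe hs)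
  rwa [e₁, e₂ _ (measurable_subtype_coe hs), hpre] at this


/-- **Area formula**, change of variables in integrals. -/
theorem integral_image_eq_integral_areaFactor_smul {E : Type*} [NormedAddCommGroup E]
    [NormedSpace ℝ E] {F : E2 → E3} {U : Set E2} (hU : IsOpen U)
    (hF : ContDiffOn ℝ 1 F U) (hinj : Set.InjOn F U)
    (hJ : ∀ z ∈ U, 0 < areaFactor (fderiv ℝ F z)) (g : E3 → E) :
    ∫ y in F '' U, g y ∂(μHE[2] : Measure E3)
      = ∫ z in U, areaFactor (fderiv ℝ F z) • g (F z) := by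
  have hemb : MeasurableEmbedding (U.domRestrict F) :=
    hF.continuousOn.measurableEmbedding hU.measurableSet hinj
  have hembv : MeasurableEmbedding (Subtype.val : U → E2) :=
    MeasurableEmbedding.subtype_coe hU.measurableSet
  have hmap : Measure.map (U.domRestrict F) (Measure.comap Subtype.val (volume.withDensity
      fun z => ENNReal.ofReal (areaFactor (fderiv ℝ F z))))
      = (μHE[2] : Measure E3).restrict (F '' U) := by
    ext E hE
    rw [hemb.map_apply, hembv.comap_apply]
    have hm := hembv.measurableSet_image.2 (hemb.measurable hE)
    rw [withDensity_apply _ hm,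
      ← euclideanHausdorffMeasure_image_eq_lintegral hU hF hinj hJ hm (by simp),
      Measure.restrict_apply hE]
    congr 1
    ext y
    constructor
    · rintro ⟨_, ⟨⟨z, hz⟩, hzE, rfl⟩, rfl⟩
      exact ⟨hzE, z, hz, rfl⟩
    · rintro ⟨hy, z, hz, rfl⟩
      exact ⟨z, ⟨⟨z, hz⟩, hy, rfl⟩, rfl⟩
  have hcont : ContinuousOn (fun z => areaFactor (fderiv ℝ F z)) U :=
    continuous_areaFactor.comp_continuousOn (hF.continuousOn_fderiv_of_isOpen hU le_rfl)
  rw [← hmap, hemb.integral_map]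
  simp only [Set.domRestrict_apply, ← Function.comp_apply (f := g), ENNReal.ofReal]
  rw [← hembv.integral_map, map_comap_subtype_coe hU.measurableSet,
    setIntegral_withDensity_eq_setIntegral_smul₀
      (hcont.aemeasurable hU.measurableSet).real_toNNReal _ hU.measurableSet]
  refine setIntegral_congr_fun hU.measurableSet fun z hz => ?_
  simp only [Function.comp_apply]
  rw [NNReal.smul_def, Real.coe_toNNReal _ (hJ z hz).le]

/-! ### Integration over curved elements and meshes -/

namespace ReferenceElement

variable (That : ReferenceElement)

theorem uniqueDiffOn : UniqueDiffOn ℝ That.carrier :=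
  uniqueDiffOn_convex That.convex That.interior_nonempty

theorem volume_frontier : volume (frontier That.carrier) = 0 :=
  That.convex.addHaar_frontier volume

theorem interior_ae_eq : (interior That.carrier : Set E2) =ᵐ[volume] That.carrier :=
  interior_ae_eq_of_null_frontier That.volume_frontier

theorem subset_closure_interior : That.carrier ⊆ closure (interior That.carrier) := by
  rw [That.convex.closure_interior_eq_closure_of_nonempty_interior That.interior_nonempty]
  exact subset_closure

end ReferenceElement

theorem surfaceJacobian_eq_areaFactor (That : ReferenceElement) (F : E2 → E3) (z : E2) :
    surfaceJacobian That F z = areaFactor (fderivWithin ℝ F That.carrier z) := rfl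

theorem fderivWithin_eq_fderiv_of_mem_interior {That : ReferenceElement} {F : E2 → E3} {z : E2}
    (hz : z ∈ interior That.carrier) : fderivWithin ℝ F That.carrier z = fderiv ℝ F z :=
  fderivWithin_of_mem_nhds (mem_interior_iff_mem_nhds.1 hz)

/-- The frontier of a convex set is Lebesgue null, and a `C¹` map on a compact convex set is
Lipschitz. Hence element boundaries do not contribute to surface integrals. -/
theorem euclideanHausdorffMeasure_image_frontier {That : ReferenceElement} {F : E2 → E3}
    (hF : ContDiffOn ℝ 1 F That.carrier) : μHE[2] (F '' frontier That.carrier) = 0 := by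
  obtain ⟨C, hC⟩ := That.compact.exists_bound_of_continuousOn
    (hF.continuousOn_fderivWithin That.uniqueDiffOn le_rfl)
  have hL : LipschitzOnWith C.toNNReal F That.carrier :=
    That.convex.lipschitzOnWith_of_nnnorm_fderivWithin_le (hF.differentiableOn one_ne_zero)
      fun z hz => NNReal.le_toNNReal_of_coe_le (hC z hz)
  have hsub : frontier That.carrier ⊆ That.carrier := That.compact.isClosed.frontier_subset
  have := euclideanHausdorffMeasure_image_le_of_dist_le (f := F) (g := id)
    (s := frontier That.carrier) (K := C.toNNReal) 2
    fun z hz w hw => hL.dist_le_mul z (hsub hz) w (hsub hw)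
  rw [Set.image_id, EuclideanSpace.euclideanHausdorffMeasure_eq_volume, That.volume_frontier,
    mul_zero] at this
  exact le_antisymm this zero_le

theorem setIntegral_area_element {E : Type*} [NormedAddCommGroup E]
    [NormedSpace ℝ E] {That : ReferenceElement} {F : E2 → E3}
    (hF : ContDiffOn ℝ 1 F That.carrier) (hinj : Set.InjOn F (interior That.carrier))
    (hJ : ∀ z ∈ That.carrier, 0 < surfaceJacobian That F z) (g : E3 → E) :
    ∫ y in F '' interior That.carrier, g y ∂(μHE[2] : Measure E3)
      = ∫ z in That.carrier, surfaceJacobian That F z • g (F z) := by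
  rw [integral_image_eq_integral_areaFactor_smul isOpen_interior (hF.mono interior_subset) hinj,
    ← setIntegral_congr_set That.interior_ae_eq]
  · refine setIntegral_congr_fun isOpen_interior.measurableSet fun z hz => ?_
    simp only [surfaceJacobian_eq_areaFactor, fderivWithin_eq_fderiv_of_mem_interior hz]
  · intro z hz
    rw [← fderivWithin_eq_fderiv_of_mem_interior hz, ← surfaceJacobian_eq_areaFactor]
    exact hJ z (interior_subset hz)

/-- The surface integral is the sum of the integrals over the elements of a mesh. -/
theorem SurfaceMesh.integral_area {E : Type*} [NormedAddCommGroup E] [NormedSpace ℝ E]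
    {Γ : ClosedSurface} {That : ReferenceElement} (M : SurfaceMesh Γ That)
    (hJ : ∀ T, ∀ z ∈ That.carrier, 0 < surfaceJacobian That (M.param T) z) {g : E3 → E}
    (hg : Integrable g Γ.area) :
    ∫ y, g y ∂Γ.area = ∑ T, ∫ z in That.carrier,
      surfaceJacobian That (M.param T) z • g (M.param T z) := by
  have hF : ∀ T, ContDiffOn ℝ 1 (M.param T) That.carrier :=
    fun T => (M.smooth T).of_le (by exact_mod_cast le_top)
  have hsub : ⋃ T, M.param T '' interior That.carrier ⊆ Γ.carrier := by
    rw [← M.covers]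
    exact Set.iUnion_mono fun T => Set.image_mono interior_subset
  have hdiff : Γ.carrier \ ⋃ T, M.param T '' interior That.carrier
      ⊆ ⋃ T, M.param T '' frontier That.carrier := by
    rintro y ⟨hy, hny⟩
    rw [← M.covers, Set.mem_iUnion] at hy
    obtain ⟨T, z, hz, rfl⟩ := hy
    refine Set.mem_iUnion.2 ⟨T, z, ?_, rfl⟩
    rw [That.compact.isClosed.frontier_eq]
    exact ⟨hz, fun hzi => hny (Set.mem_iUnion.2 ⟨T, z, hzi, rfl⟩)⟩
  -- The disjoint images of the interiors exhaust `Γ` up to the null images of the frontiers.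
  have hae : (⋃ T, M.param T '' interior That.carrier : Set E3) =ᵐ[μHE[2]] Γ.carrier := by
    refine Filter.EventuallyLE.antisymm hsub.eventuallyLE (ae_le_set.2 ?_)
    refine measure_mono_null hdiff (measure_iUnion_null fun T => ?_)
    exact euclideanHausdorffMeasure_image_frontier (hF T)
  rw [ClosedSurface.area, ← setIntegral_congr_set hae, integral_iUnion_fintype]
  · exact Finset.sum_congr rfl fun T _ => setIntegral_area_element (hF T) (M.injOn T) (hJ T) g
  · exact fun T => isOpen_interior.measurableSet.image_of_continuousOn_injOn
      ((hF T).continuousOn.mono interior_subset) (M.injOn T)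
  · exact fun T T' h => M.nonoverlapping T T' h
  · intro T
    have : IntegrableOn g Γ.carrier μHE[2] := hg
    exact this.mono_set ((Set.subset_iUnion _ T).trans hsub)


/-- Orthogonal projection along a non-zero vector, in orthonormal coordinates of the plane. -/
theorem exists_projection_along {g : E3} (hg : g ≠ 0) :
    ∃ P : E3 →ₗ[ℝ] E2, ∀ v, ‖v‖ ^ 2 * ‖g‖ ^ 2 = ‖P v‖ ^ 2 * ‖g‖ ^ 2 + inner ℝ g v ^ 2 := by
  have : Fact (Module.finrank ℝ E3 = 2 + 1) := ⟨by simp⟩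
  let b := OrthonormalBasis.fromOrthogonalSpanSingleton (𝕜 := ℝ) 2 hg
  refine ⟨b.repr.toLinearEquiv.toLinearMap ∘ₗ (ℝ ∙ g)ᗮ.orthogonalProjectionOnto.toLinearMap,
    fun v => ?_⟩
  have h := Submodule.norm_sq_eq_add_norm_sq_projection v (ℝ ∙ g)
  have h1 : ‖(ℝ ∙ g).orthogonalProjectionOnto v‖ ^ 2 * ‖g‖ ^ 2 = inner ℝ g v ^ 2 := by
    have hg' : ‖g‖ ≠ 0 := norm_ne_zero_iff.2 hg
    have hn : ‖(ℝ ∙ g).orthogonalProjectionOnto v‖ = ‖(ℝ ∙ g).starProjection v‖ := rfl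
    rw [hn, Submodule.starProjection_singleton, norm_smul, mul_pow, Real.norm_eq_abs, sq_abs]
    simp
    field_simp
  have h2 : ‖(b.repr.toLinearEquiv.toLinearMap ∘ₗ
      (ℝ ∙ g)ᗮ.orthogonalProjectionOnto.toLinearMap) v‖ = ‖(ℝ ∙ g)ᗮ.orthogonalProjectionOnto v‖ := by
    simp
  rw [h2, h, add_mul, h1]
  ring

/-! ### Area growth of a closed surface -/

namespace ClosedSurface

variable (Γ : ClosedSurface)

theorem isClosed_carrier : IsClosed Γ.carrier :=
  isClosed_singleton.preimage Γ.smooth.continuous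

theorem isCompact_carrier : IsCompact Γ.carrier :=
  Metric.isCompact_of_isClosed_isBounded Γ.isClosed_carrier
    (Γ.bounded.subset fun y (hy : Γ.defFun y = 0) => hy.le)

/-- Near `x₀` a secant `v` of `Γ` is almost tangent: the defining function vanishes at both ends, so
strict differentiability gives `|g·v| ≤ |g||v|/2`. Projection along `g` then shortens `v` by at most
a factor 2, and the patch has at most `2²` times the area of a planar disc. -/
theorem exists_nhds_measure_inter_closedBall_le {x₀ : E3} (hx₀ : x₀ ∈ Γ.carrier) :
    ∃ V ∈ 𝓝 x₀, ∀ x : E3, ∀ t : ℝ, 0 ≤ t → μHE[2] (Γ.carrier ∩ V ∩ Metric.closedBall x t)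
      ≤ 2 ^ 2 * (ENNReal.ofReal (t ^ 2) * volume (Metric.closedBall (0 : E2) 1)) := by
  set g := gradient Γ.defFun x₀ with hgdef
  have hg : g ≠ 0 := Γ.regular x₀ hx₀
  have hg' : 0 < ‖g‖ := norm_pos_iff.2 hg
  obtain ⟨P, hP⟩ := exists_projection_along hg
  have hstrict := (Γ.smooth.contDiffAt (x := x₀)).hasStrictFDerivAt (by simp)
  have hs := hstrict.isLittleO.def (c := ‖g‖ / 2) (by positivity)
  rw [nhds_prod_eq] at hs
  obtain ⟨V, hV, hVs⟩ := (eventually_prod_self_iff (r := fun z w =>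
    ‖Γ.defFun z - Γ.defFun w - fderiv ℝ Γ.defFun x₀ (z - w)‖ ≤ ‖g‖ / 2 * ‖z - w‖)).1 hs
  have hPle : ∀ v, ‖P v‖ ≤ ‖v‖ := by
    intro v
    refine abs_le_of_sq_le_sq' ?_ (norm_nonneg _) |>.2
    have := hP v
    have h2 := sq_nonneg (inner ℝ g v)
    by_contra hlt
    push Not at hlt
    nlinarith [mul_lt_mul_of_pos_right hlt (pow_pos hg' 2)]
  have hdist : ∀ y ∈ Γ.carrier ∩ V, ∀ z ∈ Γ.carrier ∩ V, dist y z ≤ 2 * dist (P y) (P z) := by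
    rintro y ⟨hy, hyV⟩ z ⟨hz, hzV⟩
    have h := hVs y hyV z hzV
    have hy' : Γ.defFun y = 0 := hy
    have hz' : Γ.defFun z = 0 := hz
    rw [hy', hz', sub_zero, zero_sub, norm_neg] at h
    have hin : fderiv ℝ Γ.defFun x₀ (y - z) = inner ℝ g (y - z) := by
      rw [hgdef, inner_gradient_left]
    rw [hin, Real.norm_eq_abs] at h
    rw [dist_eq_norm, dist_eq_norm, ← map_sub]
    set v := y - z
    have hsq : inner ℝ g v ^ 2 ≤ (‖g‖ / 2 * ‖v‖) ^ 2 := by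
      rw [← sq_abs]; gcongr
    have hPv := hP v
    refine abs_le_of_sq_le_sq' ?_ (by positivity) |>.2
    have : ‖v‖ ^ 2 * ‖g‖ ^ 2 ≤ (2 * ‖P v‖) ^ 2 * ‖g‖ ^ 2 := by nlinarith [sq_nonneg (‖P v‖ * ‖g‖)]
    exact le_of_mul_le_mul_right this (by positivity)
  refine ⟨V, hV, fun x t ht => ?_⟩
  have h := euclideanHausdorffMeasure_image_le_of_dist_le (f := id) (g := P)
    (s := Γ.carrier ∩ V ∩ Metric.closedBall x t) (K := 2) 2
    fun y hy z hz => by simpa using hdist y hy.1 z hz.1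
  rw [Set.image_id, EuclideanSpace.euclideanHausdorffMeasure_eq_volume] at h
  refine h.trans ?_
  have hsub : P '' (Γ.carrier ∩ V ∩ Metric.closedBall x t) ⊆ Metric.closedBall (P x) t := by
    rintro _ ⟨y, hy, rfl⟩
    rw [Metric.mem_closedBall, dist_eq_norm, ← map_sub]
    exact (hPle _).trans (by simpa [dist_eq_norm] using hy.2)
  have hvol := Measure.addHaar_closedBall (volume : Measure E2) (P x) ht
  have hvol' := measure_mono (μ := volume) hsub
  rw [Measure.addHaar_closedBall' _ _ ht] at hvol'
  simp only [finrank_euclideanSpace, Fintype.card_fin] at hvol'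
  gcongr
  simp

/-- Upper Ahlfors regularity of a closed surface. -/
theorem exists_area_closedBall_le : ∃ C : ℝ, 0 < C ∧ ∀ x : E3, ∀ t : ℝ, 0 ≤ t →
    Γ.area (Metric.closedBall x t) ≤ ENNReal.ofReal (C * t ^ 2) := by
  choose! V hV hle using fun x₀ (hx₀ : x₀ ∈ Γ.carrier) =>
    Γ.exists_nhds_measure_inter_closedBall_le hx₀
  obtain ⟨F, hF, hcov⟩ := Γ.isCompact_carrier.elim_nhds_subcover V hV
  set v := volume (Metric.closedBall (0 : E2) 1)
  have hv : v ≠ ⊤ := measure_closedBall_lt_top.ne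
  -- Each of the finitely many patches contributes `4 v t²`; the `+ 1` secures positivity even for
  -- an empty cover.
  refine ⟨F.card * (4 * v.toReal) + 1, by positivity, fun x t ht => ?_⟩
  rw [ClosedSurface.area, Measure.restrict_apply measurableSet_closedBall]
  calc μHE[2] (Metric.closedBall x t ∩ Γ.carrier)
      ≤ μHE[2] (⋃ x₀ ∈ F, Γ.carrier ∩ V x₀ ∩ Metric.closedBall x t) := by
        refine measure_mono fun y hy => ?_
        obtain ⟨x₀, hx₀, hy'⟩ := Set.mem_iUnion₂.1 (hcov hy.2)
        exact Set.mem_iUnion₂.2 ⟨x₀, hx₀, ⟨hy.2, hy'⟩, hy.1⟩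
    _ ≤ ∑ x₀ ∈ F, μHE[2] (Γ.carrier ∩ V x₀ ∩ Metric.closedBall x t) :=
        measure_biUnion_finset_le _ _
    _ ≤ ∑ x₀ ∈ F, 2 ^ 2 * (ENNReal.ofReal (t ^ 2) * v) :=
        Finset.sum_le_sum fun x₀ hx₀ => hle x₀ (hF x₀ hx₀) x t ht
    _ = ENNReal.ofReal (F.card * (4 * v.toReal) * t ^ 2) := by
        rw [Finset.sum_const, nsmul_eq_mul, ← ENNReal.ofReal_toReal hv,
          ← ENNReal.ofReal_mul (by positivity), ENNReal.toReal_ofReal (by positivity)]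
        rw [show (2 : ENNReal) ^ 2 = ENNReal.ofReal 4 by norm_num,
          ← ENNReal.ofReal_mul (by positivity), ← ENNReal.ofReal_natCast,
          ← ENNReal.ofReal_mul (by positivity)]
        congr 1; ring
    _ ≤ _ := ENNReal.ofReal_le_ofReal (by nlinarith [sq_nonneg t])

instance : IsFiniteMeasure Γ.area := by
  obtain ⟨C, -, h⟩ := Γ.exists_area_closedBall_le
  obtain ⟨R, hR⟩ := Γ.isCompact_carrier.isBounded.subset_closedBall 0
  refine ⟨?_⟩
  have hun : Γ.area Set.univ ≤ Γ.area (Metric.closedBall 0 (max R 0)) := by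
    simp only [ClosedSurface.area]
    rw [Measure.restrict_apply_univ, Measure.restrict_apply measurableSet_closedBall]
    exact measure_mono fun y hy =>
      ⟨Metric.closedBall_subset_closedBall (le_max_left _ _) (hR hy), hy⟩
  exact hun.trans_lt ((h _ _ (le_max_right _ _)).trans_lt ENNReal.ofReal_lt_top)

theorem ae_mem_carrier : ∀ᵐ y ∂Γ.area, y ∈ Γ.carrier :=
  ae_restrict_mem Γ.isClosed_carrier.measurableSet

/-- A function that is continuous on `Γ` is integrable on `Γ`. -/
theorem integrable_of_continuousOn {E : Type*} [NormedAddCommGroup E]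
    {g : E3 → E} (hg : ContinuousOn g Γ.carrier) : Integrable g Γ.area := by
  obtain ⟨C, hC⟩ := Γ.isCompact_carrier.exists_bound_of_continuousOn hg
  refine Integrable.of_bound (C := C) ?_ ?_
  · exact hg.aestronglyMeasurable_of_isCompact Γ.isCompact_carrier Γ.isClosed_carrier.measurableSet
  · filter_upwards [Γ.ae_mem_carrier] with y hy using hC y hy

theorem exists_dist_le : ∃ R : ℝ, 0 < R ∧ ∀ x ∈ Γ.carrier, ∀ y ∈ Γ.carrier, ‖y - x‖ ≤ R := by
  obtain ⟨R, hR⟩ := Metric.isBounded_iff.1 Γ.isCompact_carrier.isBounded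
  exact ⟨max R 1, by positivity, fun x hx y hy => by
    rw [← dist_eq_norm]; exact (hR hy hx).trans (le_max_left _ _)⟩

/-- The integral of `(δ + |x - y|)⁻³` over the surface is `O(δ⁻¹)`. -/
theorem exists_integral_inv_cube_le : ∃ C : ℝ, 0 < C ∧ ∀ x ∈ Γ.carrier, ∀ δ : ℝ, 0 < δ →
    ∫ y, ((δ + ‖y - x‖) ^ 3)⁻¹ ∂Γ.area ≤ C / δ := by
  obtain ⟨C, hC, hball⟩ := Γ.exists_area_closedBall_le
  obtain ⟨R, hR, hdist⟩ := Γ.exists_dist_le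
  refine ⟨16 * C, by positivity, fun x hx δ hδ => ?_⟩
  -- The number of dyadic balls about `x` needed to exhaust `Γ`; it depends on `δ`, but the
  -- geometric series below is bounded independently of it.
  obtain ⟨K, hK⟩ : ∃ K : ℕ, δ + R ≤ 2 ^ K * δ := by
    obtain ⟨K, hK⟩ := pow_unbounded_of_one_lt ((δ + R) / δ) (one_lt_two)
    exact ⟨K, by rw [div_lt_iff₀ hδ] at hK; exact hK.le⟩
  have hreal : ∀ t : ℝ, 0 ≤ t → Γ.area.real (Metric.closedBall x t) ≤ C * t ^ 2 := fun t ht =>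
    ENNReal.toReal_le_of_le_ofReal (by positivity) (hball x t ht)
  let f : ℕ → E3 → ℝ := fun k =>
    (Metric.closedBall x (2 ^ k * δ)).indicator fun _ => 8 * ((2 ^ k * δ) ^ 3)⁻¹
  have hf0 : ∀ k y, 0 ≤ f k y := fun k y => Set.indicator_nonneg (fun _ _ => by positivity) y
  have hfi : ∀ k, Integrable (f k) Γ.area := fun k =>
    (integrable_const _).indicator measurableSet_closedBall
  have hpt : ∀ y ∈ Γ.carrier,
      ((δ + ‖y - x‖) ^ 3)⁻¹ ≤ ∑ k ∈ Finset.range (K + 1), f k y := by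
    intro y hy
    have hex : ∃ k : ℕ, δ + ‖y - x‖ ≤ 2 ^ k * δ :=
      ⟨K, (by linarith [hdist x hx y hy] : δ + ‖y - x‖ ≤ δ + R).trans hK⟩
    classical
    set k := Nat.find hex with hk
    have hk1 : δ + ‖y - x‖ ≤ 2 ^ k * δ := Nat.find_spec hex
    have hkK : k ≤ K :=
      Nat.find_min' hex ((by linarith [hdist x hx y hy] : δ + ‖y - x‖ ≤ δ + R).trans hK)
    -- Minimality of `k` makes `δ + |y - x|` comparable to `2^k δ`; the cube of this factor 2 is the
    -- 8 in `f`.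
    have hk2 : 2 ^ k * δ ≤ 2 * (δ + ‖y - x‖) := by
      rcases Nat.eq_zero_or_pos k with h0 | hpos
      · rw [h0]; nlinarith [norm_nonneg (y - x)]
      · have := Nat.find_min hex (Nat.sub_lt hpos one_pos)
        push Not at this
        obtain ⟨j, hj⟩ := Nat.exists_eq_succ_of_ne_zero hpos.ne'
        rw [← hk, hj, Nat.succ_sub_one] at this
        rw [hj, pow_succ]; linarith
    have hmem : y ∈ Metric.closedBall x (2 ^ k * δ) := by
      rw [Metric.mem_closedBall, dist_eq_norm]; linarith
    refine le_trans ?_ (Finset.single_le_sum (fun k _ => hf0 k y)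
      (Finset.mem_range.2 (Nat.lt_succ_of_le hkK)))
    have hpos : 0 < δ + ‖y - x‖ := by positivity
    simp only [f, Set.indicator_of_mem hmem]
    rw [← div_eq_mul_inv, inv_eq_one_div, div_le_div_iff₀ (by positivity) (by positivity)]
    calc 1 * (2 ^ k * δ) ^ 3 ≤ 1 * (2 * (δ + ‖y - x‖)) ^ 3 := by gcongr
      _ = _ := by ring
  calc ∫ y, ((δ + ‖y - x‖) ^ 3)⁻¹ ∂Γ.area
      ≤ ∫ y, ∑ k ∈ Finset.range (K + 1), f k y ∂Γ.area := by
        refine integral_mono_ae ?_ (integrable_finsetSum _ fun k _ => hfi k) ?_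
        · refine Γ.integrable_of_continuousOn (Continuous.continuousOn ?_)
          refine Continuous.inv₀ (by fun_prop) fun y => ?_
          have : 0 < δ + ‖y - x‖ := by positivity
          positivity
        · filter_upwards [Γ.ae_mem_carrier] with y hy using hpt y hy
    _ = ∑ k ∈ Finset.range (K + 1), ∫ y, f k y ∂Γ.area := integral_finsetSum _ fun k _ => hfi k
    -- Area `C (2^k δ)²` times height `8 (2^k δ)⁻³` leaves `(8C/δ) 2^{-k}`.
    _ ≤ ∑ k ∈ Finset.range (K + 1), 8 * C / δ * (1 / 2) ^ k := by
        refine Finset.sum_le_sum fun k _ => ?_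
        rw [integral_indicator_const _ measurableSet_closedBall, smul_eq_mul]
        calc _ ≤ C * (2 ^ k * δ) ^ 2 * (8 * ((2 ^ k * δ) ^ 3)⁻¹) := by
              gcongr; exact hreal _ (by positivity)
          _ = _ := by rw [one_div, inv_pow]; field_simp
    _ ≤ 8 * C / δ * 2 := by
        rw [← Finset.mul_sum]
        gcongr
        exact sum_geometric_two_le _
    _ = _ := by ring

end ClosedSurface


/-! ### Quadrature error on the reference element -/

theorem multilinear_diagonal_eq_sum {k : ℕ} (M : E2 [×k]→L[ℝ] ℂ) (z₀ z : E2) :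
    M (fun _ => z - z₀) = ∑ r : Fin k → Fin 2,
      ((MvPolynomial.eval z.ofLp (∏ i, (MvPolynomial.X (r i) - MvPolynomial.C (z₀ (r i)))) : ℝ)
        : ℂ) * M fun i => EuclideanSpace.single (r i) 1 := by
  have hv : z - z₀ = ∑ j : Fin 2, (z j - z₀ j) • EuclideanSpace.single j (1 : ℝ) := by
    ext j
    fin_cases j <;> simp
  rw [hv, M.map_sum]
  refine Finset.sum_congr rfl fun r _ => ?_
  rw [M.map_smul_univ (fun i => z (r i) - z₀ (r i)), map_prod]
  simp

theorem totalDegree_prod_X_sub_C_le {k : ℕ} (r : Fin k → Fin 2) (z₀ : E2) :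
    (∏ i, (MvPolynomial.X (r i) - MvPolynomial.C (z₀ (r i)) :
      MvPolynomial (Fin 2) ℝ)).totalDegree ≤ k := by
  refine (MvPolynomial.totalDegree_finsetProd _ _).trans ?_
  refine (Finset.sum_le_card_nsmul _ _ 1 fun i _ => ?_).trans (by simp)
  exact (MvPolynomial.totalDegree_sub_C_le _ _).trans (by simp)

namespace QuadratureRule

variable {That : ReferenceElement} {q : ℕ} (Q : QuadratureRule That q)

/-- The value of the rule on a function. -/
noncomputable def apply (G : E2 → ℂ) : ℂ := ∑ j, (Q.weight j : ℂ) * G (Q.node j)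

/-- In coordinates the diagonal of a `k`-linear form is a combination of polynomials of degree at
most `k`, to each of which exactness applies. This makes the rule exact on Taylor polynomials
without rewriting them in monomials. -/
theorem integral_multilinear_diagonal {k : ℕ} (hk : k ≤ q) (M : E2 [×k]→L[ℝ] ℂ) (z₀ : E2) :
    ∫ z in That.carrier, M (fun _ => z - z₀) = Q.apply fun z => M fun _ => z - z₀ := by
  simp only [multilinear_diagonal_eq_sum M z₀, apply]
  have hc : ∀ P : MvPolynomial (Fin 2) ℝ, Continuous fun z : E2 => MvPolynomial.eval z.ofLp P :=
    fun P => (MvPolynomial.continuous_eval P).comp (PiLp.continuous_ofLp 2 _)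
  rw [integral_finsetSum]
  · simp_rw [Finset.mul_sum]
    rw [Finset.sum_comm]
    refine Finset.sum_congr rfl fun r _ => ?_
    rw [integral_mul_const, integral_complex_ofReal,
      ← Q.exact _ ((totalDegree_prod_X_sub_C_le r z₀).trans hk)]
    push_cast
    rw [Finset.sum_mul]
    exact Finset.sum_congr rfl fun j _ => by ring
  · intro r _
    exact ((Complex.continuous_ofReal.comp (hc _)).mul continuous_const).continuousOn.integrableOn_compact
      That.compact

/-- The Taylor polynomial of degree `q` at an interior point. -/
noncomputable def taylor (q : ℕ) (G : E2 → ℂ) (z₀ z : E2) : ℂ :=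
  ∑ k ∈ Finset.range (q + 1), ((k.factorial : ℝ)⁻¹ • iteratedFDeriv ℝ k G z₀) fun _ => z - z₀

theorem continuous_taylor (q : ℕ) (G : E2 → ℂ) (z₀ : E2) : Continuous (taylor q G z₀) := by
  unfold taylor
  fun_prop

theorem integral_taylor (G : E2 → ℂ) (z₀ : E2) :
    ∫ z in That.carrier, taylor q G z₀ z = Q.apply (taylor q G z₀) := by
  unfold taylor
  rw [integral_finsetSum]
  · simp only [apply, Finset.mul_sum]
    rw [Finset.sum_comm]
    refine Finset.sum_congr rfl fun k hk => ?_
    exact Q.integral_multilinear_diagonal (Nat.lt_succ_iff.1 (Finset.mem_range.1 hk)) _ z₀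
  · intro k _
    exact (Continuous.continuousOn (by fun_prop)).integrableOn_compact That.compact

/-- Taylor's formula with integral remainder along the segment from `z₀`, which stays in the
interior by convexity; there the derivatives within the element are ordinary derivatives. -/
theorem norm_sub_taylor_le_of_interior {G : E2 → ℂ} (hG : ContDiffOn ℝ (q + 1) G That.carrier)
    {S : ℝ} (hS : ∀ z ∈ That.carrier, ‖iteratedFDerivWithin ℝ (q + 1) G That.carrier z‖ ≤ S)
    {z₀ z : E2} (hz₀ : z₀ ∈ interior That.carrier) (hz : z ∈ interior That.carrier) :
    ‖G z - taylor q G z₀ z‖ ≤ S * ‖z - z₀‖ ^ (q + 1) := by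
  have hseg : ∀ t ∈ Set.Icc (0 : ℝ) 1, z₀ + t • (z - z₀) ∈ interior That.carrier := fun t ht =>
    That.convex.interior.add_smul_sub_mem hz₀ hz ht
  have hat : ∀ y ∈ interior That.carrier, ContDiffAt ℝ (q + 1) G y := fun y hy =>
    hG.contDiffAt (mem_interior_iff_mem_nhds.1 hy)
  have h := map_add_eq_sum_add_integral_iteratedFDeriv (f := G) (x := z₀) (y := z - z₀) (n := q)
    fun t ht => hat _ (hseg t ht)
  rw [add_sub_cancel] at h
  have hT : taylor q G z₀ z = ∑ k ∈ Finset.range (q + 1),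
      (k.factorial : ℝ)⁻¹ • (iteratedFDeriv ℝ k G z₀ fun _ => z - z₀) := rfl
  rw [hT, h, add_sub_cancel_left, norm_smul]
  have hS0 : 0 ≤ S := (norm_nonneg _).trans (hS z₀ (interior_subset hz₀))
  have hint : ‖∫ t in (0 : ℝ)..1, (1 - t) ^ q •
      iteratedFDeriv ℝ (q + 1) G (z₀ + t • (z - z₀)) fun _ => z - z₀‖
      ≤ S * ‖z - z₀‖ ^ (q + 1) * |1 - 0| := by
    refine intervalIntegral.norm_integral_le_of_norm_le_const fun t ht => ?_
    rw [Set.uIoc_of_le zero_le_one] at ht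
    have hmem := hseg t ⟨ht.1.le, ht.2⟩
    have hd : ‖iteratedFDeriv ℝ (q + 1) G (z₀ + t • (z - z₀))‖ ≤ S := by
      rw [← iteratedFDerivWithin_eq_iteratedFDeriv That.uniqueDiffOn (hat _ hmem)
        (interior_subset hmem)]
      exact hS _ (interior_subset hmem)
    rw [norm_smul]
    have h1 : ‖(1 - t) ^ q‖ ≤ 1 := by
      rw [norm_pow]
      refine pow_le_one₀ (norm_nonneg _) ?_
      rw [Real.norm_eq_abs, abs_le]
      constructor <;> linarith [ht.1, ht.2]
    have h2 := (iteratedFDeriv ℝ (q + 1) G (z₀ + t • (z - z₀))).le_opNorm fun _ => z - z₀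
    simp only [Finset.prod_const, Finset.card_univ, Fintype.card_fin] at h2
    calc _ ≤ 1 * (S * ‖z - z₀‖ ^ (q + 1)) := by
          gcongr
          exact h2.trans (by gcongr)
      _ = _ := one_mul _
  have hfac : ‖((q.factorial : ℝ))⁻¹‖ ≤ 1 := by
    rw [norm_inv, Real.norm_natCast]
    exact inv_le_one_of_one_le₀ (by exact_mod_cast q.factorial_pos)
  calc _ ≤ 1 * (S * ‖z - z₀‖ ^ (q + 1) * |1 - 0|) := by gcongr
    _ = _ := by simp

/-- Follows by continuity from the interior; needed because quadrature nodes may lie on the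
boundary. -/
theorem norm_sub_taylor_le {G : E2 → ℂ} (hG : ContDiffOn ℝ (q + 1) G That.carrier)
    {S : ℝ} (hS : ∀ z ∈ That.carrier, ‖iteratedFDerivWithin ℝ (q + 1) G That.carrier z‖ ≤ S)
    {z₀ z : E2} (hz₀ : z₀ ∈ interior That.carrier) (hz : z ∈ That.carrier) :
    ‖G z - taylor q G z₀ z‖ ≤ S * ‖z - z₀‖ ^ (q + 1) := by
  have hcl := That.subset_closure_interior hz
  have hnb : (𝓝[interior That.carrier] z).NeBot := mem_closure_iff_nhdsWithin_neBot.1 hcl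
  have h1 : Tendsto (fun z => ‖G z - taylor q G z₀ z‖) (𝓝[interior That.carrier] z)
      (𝓝 ‖G z - taylor q G z₀ z‖) :=
    (((hG.continuousOn z hz).mono interior_subset).sub
      (continuous_taylor q G z₀).continuousWithinAt).norm
  have h2 : Tendsto (fun z => S * ‖z - z₀‖ ^ (q + 1)) (𝓝[interior That.carrier] z)
      (𝓝 (S * ‖z - z₀‖ ^ (q + 1))) :=
    Continuous.continuousWithinAt (by fun_prop)
  refine le_of_tendsto_of_tendsto h1 h2 ?_
  filter_upwards [self_mem_nhdsWithin] with y hy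
  exact norm_sub_taylor_le_of_interior hG hS hz₀ hy

/-- The error of a rule that is exact of degree `q` is controlled by the derivative of order
`q + 1`. -/
theorem exists_error_le : ∃ C : ℝ, 0 < C ∧ ∀ G : E2 → ℂ, ContDiffOn ℝ (q + 1) G That.carrier →
    ∀ S : ℝ, (∀ z ∈ That.carrier, ‖iteratedFDerivWithin ℝ (q + 1) G That.carrier z‖ ≤ S) →
      ‖(∫ z in That.carrier, G z) - Q.apply G‖ ≤ C * S := by
  obtain ⟨z₀, hz₀⟩ := That.interior_nonempty
  set D := Metric.diam That.carrier with hD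
  have hD0 : 0 ≤ D := Metric.diam_nonneg
  refine ⟨D ^ (q + 1) * volume.real That.carrier + ∑ j, Q.weight j * D ^ (q + 1) + 1, ?_, ?_⟩
  · have : 0 ≤ ∑ j, Q.weight j * D ^ (q + 1) :=
      Finset.sum_nonneg fun j _ => mul_nonneg (Q.weight_pos j).le (by positivity)
    positivity
  intro G hG S hS
  have hS0 : 0 ≤ S := (norm_nonneg _).trans (hS z₀ (interior_subset hz₀))
  have hR : ∀ z ∈ That.carrier, ‖G z - taylor q G z₀ z‖ ≤ S * D ^ (q + 1) := by
    intro z hz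
    refine (norm_sub_taylor_le hG hS hz₀ hz).trans ?_
    rw [← dist_eq_norm]
    gcongr
    exact Metric.dist_le_diam_of_mem That.compact.isBounded hz (interior_subset hz₀)
  have hGi : IntegrableOn G That.carrier := hG.continuousOn.integrableOn_compact That.compact
  have hTi : IntegrableOn (taylor q G z₀) That.carrier :=
    (continuous_taylor q G z₀).continuousOn.integrableOn_compact That.compact
  -- The integral and the rule agree on the Taylor polynomial, so only the remainder is left in
  -- both.
  have hsplit : (∫ z in That.carrier, G z) - Q.apply G
      = (∫ z in That.carrier, (G z - taylor q G z₀ z))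
        - ∑ j, (Q.weight j : ℂ) * (G (Q.node j) - taylor q G z₀ (Q.node j)) := by
    rw [integral_sub hGi hTi, Q.integral_taylor]
    simp only [apply, mul_sub, Finset.sum_sub_distrib]
    ring
  have h1 : ‖∫ z in That.carrier, (G z - taylor q G z₀ z)‖
      ≤ S * D ^ (q + 1) * volume.real That.carrier :=
    norm_setIntegral_le_of_norm_le_const That.compact.measure_lt_top hR
  have h2 : ‖∑ j, (Q.weight j : ℂ) * (G (Q.node j) - taylor q G z₀ (Q.node j))‖
      ≤ ∑ j, Q.weight j * (S * D ^ (q + 1)) := by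
    refine norm_sum_le_of_le _ fun j _ => ?_
    rw [norm_mul, Complex.norm_real, Real.norm_of_nonneg (Q.weight_pos j).le]
    exact mul_le_mul_of_nonneg_left (hR _ (Q.node_mem j)) (Q.weight_pos j).le
  rw [hsplit]
  refine (norm_sub_le _ _).trans ((add_le_add h1 h2).trans ?_)
  have : ∑ j, Q.weight j * (S * D ^ (q + 1)) = S * ∑ j, Q.weight j * D ^ (q + 1) := by
    rw [Finset.mul_sum]; exact Finset.sum_congr rfl fun j _ => by ring
  rw [this]
  nlinarith

end QuadratureRule


/-- Data for measuring the derivatives up to order `order` of a family of functions on `dom`, each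
at its own point `pt a` and on its own inverse length scale `scale a`. -/
structure JetFrame (κ E : Type*) [NormedAddCommGroup E] [NormedSpace ℝ E] where
  dom : Set E
  order : ℕ
  pt : κ → E
  scale : κ → ℝ
  uniqueDiffOn : UniqueDiffOn ℝ dom
  pt_mem : ∀ a, pt a ∈ dom
  scale_nonneg : ∀ a, 0 ≤ scale a

/-! ### Calculus of scaled derivative bounds -/

namespace JetFrame

variable {κ E V W X : Type*} [NormedAddCommGroup E] [NormedSpace ℝ E]
  [NormedAddCommGroup V] [NormedSpace ℝ V] [NormedAddCommGroup W] [NormedSpace ℝ W]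
  [NormedAddCommGroup X] [NormedSpace ℝ X] (J : JetFrame κ E)

/-- The derivatives of order `i` of the functions `f a` at the points `pt a` are bounded by
`C * b a * (Λ * scale a) ^ i`, with constants that do not depend on `a`. -/
def Bounded (f : κ → E → V) (b : κ → ℝ) : Prop :=
  ∃ C Λ : ℝ, 0 ≤ C ∧ 1 ≤ Λ ∧ ∀ a, ContDiffOn ℝ J.order (f a) J.dom ∧
    ∀ i ≤ J.order, ‖iteratedFDerivWithin ℝ i (f a) J.dom (J.pt a)‖
      ≤ C * b a * (Λ * J.scale a) ^ i

variable {J}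

theorem Bounded.mono {f : κ → E → V} {b b' : κ → ℝ} (hf : J.Bounded f b) {K : ℝ} (hK : 0 ≤ K)
    (h : ∀ a, b a ≤ K * b' a) : J.Bounded f b' := by
  obtain ⟨C, Λ, hC, hΛ, hf⟩ := hf
  refine ⟨C * K, Λ, by positivity, hΛ, fun a => ⟨(hf a).1, fun i hi => ((hf a).2 i hi).trans ?_⟩⟩
  have := J.scale_nonneg a
  calc _ ≤ C * (K * b' a) * (Λ * J.scale a) ^ i := by gcongr; exact h a
    _ = _ := by ring

theorem Bounded.congr {f g : κ → E → V} {b : κ → ℝ} (hf : J.Bounded f b)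
    (h : ∀ a, Set.EqOn (g a) (f a) J.dom) : J.Bounded g b := by
  obtain ⟨C, Λ, hC, hΛ, hf⟩ := hf
  refine ⟨C, Λ, hC, hΛ, fun a => ⟨(hf a).1.congr (h a), fun i hi => ?_⟩⟩
  rw [iteratedFDerivWithin_congr (h a) (J.pt_mem a)]
  exact (hf a).2 i hi

theorem bounded_const {c : κ → V} {b : κ → ℝ} {K : ℝ} (hb : ∀ a, 0 ≤ b a) (hK : 0 ≤ K)
    (h : ∀ a, ‖c a‖ ≤ K * b a) : J.Bounded (fun a _ => c a) b := by
  refine ⟨K, 1, hK, le_rfl, fun a => ⟨contDiffOn_const, fun i _ => ?_⟩⟩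
  have h0 := J.scale_nonneg a
  have h1 := hb a
  rcases Nat.eq_zero_or_pos i with rfl | hi
  · simpa using h a
  · rw [iteratedFDerivWithin_const_of_ne hi.ne']
    simp only [Pi.zero_apply, norm_zero]
    positivity

/-- Leibniz' rule: the binomial sum of the two bounds is exactly a power of `Λ + Λ'`, so the
geometric form survives products. -/
theorem Bounded.bilin (L : V →L[ℝ] W →L[ℝ] X) {f : κ → E → V} {g : κ → E → W} {b b' : κ → ℝ}
    (hb : ∀ a, 0 ≤ b a) (hb' : ∀ a, 0 ≤ b' a) (hf : J.Bounded f b) (hg : J.Bounded g b') :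
    J.Bounded (fun a y => L (f a y) (g a y)) (fun a => b a * b' a) := by
  obtain ⟨C, Λ, hC, hΛ, hf⟩ := hf
  obtain ⟨C', Λ', hC', hΛ', hg⟩ := hg
  refine ⟨‖L‖ * (C * C'), Λ + Λ', by positivity, by linarith, fun a =>
    ⟨?_, fun i hi => ?_⟩⟩
  · exact L.isBoundedBilinearMap.contDiff.comp_contDiffOn ((hf a).1.prodMk (hg a).1)
  have h0 := J.scale_nonneg a
  have h1 := hb a
  have h2 := hb' a
  refine (L.norm_iteratedFDerivWithin_le_of_bilinear (hf a).1 (hg a).1 J.uniqueDiffOn (J.pt_mem a)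
    (n := i) (by exact_mod_cast hi)).trans ?_
  calc _ ≤ ‖L‖ * ∑ j ∈ Finset.range (i + 1), (i.choose j : ℝ)
        * (C * b a * (Λ * J.scale a) ^ j) * (C' * b' a * (Λ' * J.scale a) ^ (i - j)) := by
        gcongr with j hj
        · have hj' : j ≤ i := Nat.lt_succ_iff.1 (Finset.mem_range.1 hj)
          exact (hf a).2 j (hj'.trans hi)
        · exact (hg a).2 (i - j) ((Nat.sub_le i j).trans hi)
    _ = _ := by
        rw [add_mul, add_pow, Finset.mul_sum, Finset.mul_sum]
        exact Finset.sum_congr rfl fun j _ => by ring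

theorem Bounded.mul {f g : κ → E → ℝ} {b b' : κ → ℝ} (hb : ∀ a, 0 ≤ b a) (hb' : ∀ a, 0 ≤ b' a)
    (hf : J.Bounded f b) (hg : J.Bounded g b') :
    J.Bounded (fun a y => f a y * g a y) (fun a => b a * b' a) :=
  hf.bilin (ContinuousLinearMap.mul ℝ ℝ) hb hb' hg

theorem Bounded.smul {f : κ → E → ℝ} {g : κ → E → V} {b b' : κ → ℝ} (hb : ∀ a, 0 ≤ b a)
    (hb' : ∀ a, 0 ≤ b' a) (hf : J.Bounded f b) (hg : J.Bounded g b') :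
    J.Bounded (fun a y => f a y • g a y) (fun a => b a * b' a) :=
  hf.bilin (ContinuousLinearMap.lsmul ℝ ℝ) hb hb' hg

theorem Bounded.inner {f g : κ → E → E3} {b b' : κ → ℝ} (hb : ∀ a, 0 ≤ b a) (hb' : ∀ a, 0 ≤ b' a)
    (hf : J.Bounded f b) (hg : J.Bounded g b') :
    J.Bounded (fun a y => (inner ℝ (f a y) (g a y) : ℝ)) (fun a => b a * b' a) :=
  hf.bilin (innerSL ℝ) hb hb' hg

/-- Composition: the inner functions vary at the scale `μ`, and the outer functions have
derivatives of order `i` bounded by `μ ^ (-i)`. -/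
theorem Bounded.comp {f : κ → E → V} {g : κ → V → W} {t : κ → Set V} {μ b : κ → ℝ} {K : ℝ}
    (hμ : ∀ a, 0 < μ a) (hb : ∀ a, 0 ≤ b a) (hK : 0 ≤ K) (hf : J.Bounded f μ)
    (ht : ∀ a, UniqueDiffOn ℝ (t a)) (hft : ∀ a, Set.MapsTo (f a) J.dom (t a))
    (hg : ∀ a, ContDiffOn ℝ J.order (g a) (t a))
    (hgb : ∀ a, ∀ i ≤ J.order, ‖iteratedFDerivWithin ℝ i (g a) (t a) (f a (J.pt a))‖ * μ a ^ i
      ≤ K * b a) :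
    J.Bounded (fun a y => g a (f a y)) b := by
  obtain ⟨C, Λ, hC, hΛ, hf⟩ := hf
  -- The factorial and the form of the rate come from the Faà di Bruno estimate, whose inner bounds
  -- must be pure powers `D ^ j`; the prefactor `C` is therefore moved into the rate.
  refine ⟨J.order.factorial * K, (C + 1) * Λ, by positivity, by nlinarith, fun a =>
    ⟨(hg a).comp (hf a).1 (hft a), fun i hi => ?_⟩⟩
  have h0 := J.scale_nonneg a
  have h1 := hμ a
  have h2 := hb a
  -- rescale the intermediate variable by `μ`
  let e : V ≃L[ℝ] V := ContinuousLinearEquiv.smulLeft (Units.mk0 (μ a) h1.ne')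
  have he : ∀ v, e v = μ a • v := fun v => rfl
  have hes : ∀ v, e.symm v = (μ a)⁻¹ • v := fun v => rfl
  have hcomp : (fun y => g a (f a y)) = (g a ∘ e) ∘ (e.symm ∘ f a) := by
    ext y; simp
  have hu : UniqueDiffOn ℝ (e ⁻¹' t a) := (e.uniqueDiffOn_preimage_iff).2 (ht a)
  have hfs : ContDiffOn ℝ J.order (e.symm ∘ f a) J.dom := e.symm.contDiff.comp_contDiffOn (hf a).1
  have hge : ContDiffOn ℝ J.order (g a ∘ e) (e ⁻¹' t a) :=
    (hg a).comp e.contDiff.contDiffOn fun _ h => h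
  simp only [hcomp]
  have hmain := norm_iteratedFDerivWithin_comp_le (n := i) hge hfs (by exact_mod_cast hi) hu
    J.uniqueDiffOn (fun y hy => by simpa using hft a hy) (J.pt_mem a)
    (C := K * b a) (D := (C + 1) * Λ * J.scale a) ?_ ?_
  · refine hmain.trans ?_
    rw [mul_assoc (J.order.factorial : ℝ)]
    gcongr
  · intro j hj
    have hmem : e ((e.symm ∘ f a) (J.pt a)) ∈ t a := by simpa using hft a (J.pt_mem a)
    rw [ContinuousLinearEquiv.iteratedFDerivWithin_comp_right e (g a) (ht a) hmem j]
    have hn : ‖(iteratedFDerivWithin ℝ j (g a) (t a) (f a (J.pt a))).compContinuousLinearMap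
        fun _ => (e : V →L[ℝ] V)‖
        ≤ ‖iteratedFDerivWithin ℝ j (g a) (t a) (f a (J.pt a))‖ * μ a ^ j := by
      refine (ContinuousMultilinearMap.norm_compContinuousLinearMap_le _ _).trans ?_
      simp only [Finset.prod_const, Finset.card_univ, Fintype.card_fin]
      gcongr
      refine ContinuousLinearMap.opNorm_le_bound _ h1.le fun v => ?_
      rw [ContinuousLinearEquiv.coe_coe, he, norm_smul, Real.norm_of_nonneg h1.le]
    simp only [Function.comp_apply, ContinuousLinearEquiv.apply_symm_apply]
    exact hn.trans (hgb a j (hj.trans hi))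
  · intro j hj1 hj
    have hl := (e.symm : V →L[ℝ] V).norm_iteratedFDerivWithin_comp_left
      ((hf a).1 _ (J.pt_mem a)) J.uniqueDiffOn (J.pt_mem a) (n := j)
      (by exact_mod_cast hj.trans hi)
    have hen : ‖(e.symm : V →L[ℝ] V)‖ ≤ (μ a)⁻¹ := by
      refine ContinuousLinearMap.opNorm_le_bound _ (by positivity) fun v => ?_
      rw [ContinuousLinearEquiv.coe_coe, hes, norm_smul, norm_inv, Real.norm_of_nonneg h1.le]
    refine hl.trans ?_
    calc _ ≤ (μ a)⁻¹ * (C * μ a * (Λ * J.scale a) ^ j) := by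
          gcongr
          exact (hf a).2 j (hj.trans hi)
      _ = C * (Λ * J.scale a) ^ j := by field_simp
      -- Uses `j ≥ 1`; the `+ 1` guarantees a base of at least 1.
      _ ≤ (C + 1) ^ j * (Λ * J.scale a) ^ j := by
          gcongr
          exact (by linarith : C ≤ C + 1).trans (le_self_pow₀ (by linarith) (by omega))
      _ = _ := by simp only [mul_pow]; ring

/-- Composition with a fixed smooth function, on a compact set of values. -/
theorem Bounded.comp_of_isCompact {f : κ → E → V} {g : V → W} {t k : Set V} (ht : IsOpen t)
    (hk : IsCompact k) (hkt : k ⊆ t) (hf : J.Bounded f fun _ => 1)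
    (hft : ∀ a, Set.MapsTo (f a) J.dom t) (hfk : ∀ a, f a (J.pt a) ∈ k)
    (hg : ContDiffOn ℝ J.order g t) :
    J.Bounded (fun a y => g (f a y)) fun _ => 1 := by
  have hex : ∀ i : ℕ, ∃ B : ℝ, i ≤ J.order → ∀ v ∈ k, ‖iteratedFDerivWithin ℝ i g t v‖ ≤ B := by
    intro i
    by_cases hi : i ≤ J.order
    · obtain ⟨B, hB⟩ := hk.exists_bound_of_continuousOn
        ((hg.continuousOn_iteratedFDerivWithin (m := i) (by exact_mod_cast hi)
          ht.uniqueDiffOn).mono hkt)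
      exact ⟨B, fun _ => hB⟩
    · exact ⟨0, fun h => absurd h hi⟩
  choose B hB using hex
  refine hf.comp (g := fun _ => g) (t := fun _ => t) (K := ∑ i ∈ Finset.range (J.order + 1), |B i|)
    (fun _ => one_pos) (fun _ => zero_le_one) (Finset.sum_nonneg fun _ _ => abs_nonneg _)
    (fun _ => ht.uniqueDiffOn) hft (fun _ => hg) fun a i hi => ?_
  rw [one_pow, mul_one, mul_one]
  refine ((hB i hi _ (hfk a)).trans (le_abs_self _)).trans ?_
  exact Finset.single_le_sum (f := fun i => |B i|) (fun _ _ => abs_nonneg _)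
    (Finset.mem_range.2 (Nat.lt_succ_of_le hi))

end JetFrame


/-! ### The radial kernels as smooth functions of the squared distance -/

/-- The integral `∫₀¹ u^{2m} e^{-w u²} du`. -/
noncomputable def gaussMoment (m : ℕ) (w : ℝ) : ℝ :=
  ∫ u in (0 : ℝ)..1, u ^ (2 * m) * Real.exp (-w * u ^ 2)

/-- Differentiation under the integral brings down `-u²`, so the moments are closed under
differentiation. On the unit ball about `w` the integrand is dominated by `exp(|w| + 1)`. -/
theorem hasDerivAt_gaussMoment (m : ℕ) (w : ℝ) :
    HasDerivAt (gaussMoment m) (-gaussMoment (m + 1) w) w := by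
  have h := (intervalIntegral.hasDerivAt_integral_of_dominated_loc_of_deriv_le
    (F := fun w u => u ^ (2 * m) * Real.exp (-w * u ^ 2))
    (F' := fun w u => -(u ^ (2 * (m + 1)) * Real.exp (-w * u ^ 2)))
    (bound := fun _ => Real.exp (|w| + 1)) (a := 0) (b := 1) (μ := volume)
    (Metric.ball_mem_nhds w one_pos) (Eventually.of_forall fun w => by fun_prop)
    (Continuous.intervalIntegrable (by fun_prop) _ _) (by fun_prop) ?_
    (Continuous.intervalIntegrable (by fun_prop) _ _) ?_).2
  · rw [intervalIntegral.integral_neg] at h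
    exact h
  · refine ae_of_all _ fun u hu x hx => ?_
    rw [Set.uIoc_of_le zero_le_one] at hu
    rw [norm_neg, norm_mul, norm_pow, Real.norm_of_nonneg hu.1.le, Real.norm_of_nonneg
      (Real.exp_pos _).le]
    have h1 : u ^ (2 * (m + 1)) ≤ 1 := pow_le_one₀ hu.1.le hu.2
    have h2 : -x * u ^ 2 ≤ |w| + 1 := by
      have hx' : |x| ≤ |w| + 1 := by
        rw [Metric.mem_ball, Real.dist_eq] at hx
        have := abs_sub_abs_le_abs_sub x w
        linarith
      calc -x * u ^ 2 ≤ |x| * 1 := by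
            refine mul_le_mul (neg_le_abs x) (pow_le_one₀ hu.1.le hu.2) (by positivity)
              (abs_nonneg _)
        _ ≤ _ := by linarith
    calc _ ≤ 1 * Real.exp (|w| + 1) := by gcongr
      _ = _ := one_mul _
  · refine ae_of_all _ fun u _ x _ => ?_
    have h1 : HasDerivAt (fun w : ℝ => -w * u ^ 2) (-1 * u ^ 2) x :=
      (hasDerivAt_id x).neg.mul_const _
    have h2 := (h1.exp).const_mul (u ^ (2 * m))
    refine h2.congr_deriv ?_
    ring

theorem contDiff_gaussMoment (m : ℕ) : ContDiff ℝ ∞ (gaussMoment m) := by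
  rw [contDiff_infty]
  intro n
  induction n generalizing m with
  | zero =>
    exact contDiff_zero.2 (continuous_iff_continuousAt.2 fun w =>
      (hasDerivAt_gaussMoment m w).continuousAt)
  | succ n ih =>
    have hd : deriv (gaussMoment m) = fun w => -gaussMoment (m + 1) w :=
      funext fun w => (hasDerivAt_gaussMoment m w).deriv
    push_cast
    refine contDiff_succ_iff_deriv.2 ⟨fun w => (hasDerivAt_gaussMoment m w).differentiableAt,
      by simp, ?_⟩
    rw [hd]
    exact (ih (m + 1)).neg

theorem iteratedDeriv_gaussMoment (i m : ℕ) (w : ℝ) :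
    iteratedDeriv i (gaussMoment m) w = (-1) ^ i * gaussMoment (m + i) w := by
  induction i generalizing m with
  | zero => simp
  | succ i ih =>
    have hd : deriv (gaussMoment m) = fun w => -1 * gaussMoment (m + 1) w :=
      funext fun w => by rw [(hasDerivAt_gaussMoment m w).deriv, neg_one_mul]
    rw [iteratedDeriv_succ', hd, iteratedDeriv_const_mul_field, ih, pow_succ',
      show m + 1 + i = m + (i + 1) by ring]
    ring

theorem gaussMoment_nonneg (m : ℕ) (w : ℝ) : 0 ≤ gaussMoment m w :=
  intervalIntegral.integral_nonneg zero_le_one fun u _ => by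
    rw [pow_mul]; positivity

/-- With `c = √(1 + w)`, one has `exp(-w u²) ≤ e · exp(-(c u)²)` for `u ≤ 1`, and substituting `v =
c u` extracts `c^{-(2m+1)}` times a convergent Gauss integral. Using `1 + w` rather than `w` keeps
the bound uniform down to `w = 0`. -/
theorem exists_gaussMoment_mul_le (m : ℕ) : ∃ C : ℝ, 0 ≤ C ∧ ∀ w : ℝ, 0 ≤ w →
    gaussMoment m w * √(1 + w) ^ (2 * m + 1) ≤ C := by
  have hint : IntegrableOn (fun v : ℝ => v ^ (2 * m) * Real.exp (-v ^ 2)) (Set.Ioi 0) := by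
    have := integrableOn_rpow_mul_exp_neg_mul_sq one_pos (s := ((2 * m : ℕ) : ℝ))
      (by have : (0 : ℝ) ≤ ((2 * m : ℕ) : ℝ) := Nat.cast_nonneg _
          linarith)
    refine this.congr_fun (fun v _ => ?_) measurableSet_Ioi
    simp only [Real.rpow_natCast, neg_mul, one_mul]
  have hnn : ∀ v : ℝ, 0 ≤ v ^ (2 * m) * Real.exp (-v ^ 2) := fun v => by
    rw [pow_mul]; positivity
  refine ⟨Real.exp 1 * ∫ v in Set.Ioi 0, v ^ (2 * m) * Real.exp (-v ^ 2),
    mul_nonneg (Real.exp_pos _).le (integral_nonneg hnn), fun w hw => ?_⟩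
  set c := √(1 + w) with hc
  have hc0 : 0 < c := Real.sqrt_pos.2 (by linarith)
  have hc2 : c ^ 2 = 1 + w := Real.sq_sqrt (by linarith)
  have h1 : gaussMoment m w
      ≤ ∫ u in (0 : ℝ)..1, Real.exp 1 * (u ^ (2 * m) * Real.exp (-(c * u) ^ 2)) := by
    refine intervalIntegral.integral_mono_on zero_le_one
      (Continuous.intervalIntegrable (by fun_prop) _ _)
      (Continuous.intervalIntegrable (by fun_prop) _ _) fun u hu => ?_
    rw [mul_left_comm, ← Real.exp_add]
    have : 0 ≤ u ^ (2 * m) := pow_nonneg hu.1 _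
    gcongr
    rw [mul_pow, hc2]
    nlinarith [pow_le_one₀ (n := 2) hu.1 hu.2]
  have h2 : (∫ u in (0 : ℝ)..1, u ^ (2 * m) * Real.exp (-(c * u) ^ 2)) * c ^ (2 * m + 1)
      = ∫ v in (0 : ℝ)..c, v ^ (2 * m) * Real.exp (-v ^ 2) := by
    have := intervalIntegral.mul_integral_comp_mul_left (a := 0) (b := 1) (c := c)
      (f := fun v : ℝ => v ^ (2 * m) * Real.exp (-v ^ 2))
    rw [mul_zero, mul_one] at this
    rw [← this, pow_succ, ← mul_assoc, mul_comm _ c, ← intervalIntegral.integral_mul_const]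
    congr 1
    refine intervalIntegral.integral_congr fun u _ => ?_
    simp only [mul_pow]
    ring
  have h3 : ∫ v in (0 : ℝ)..c, v ^ (2 * m) * Real.exp (-v ^ 2)
      ≤ ∫ v in Set.Ioi 0, v ^ (2 * m) * Real.exp (-v ^ 2) := by
    rw [intervalIntegral.integral_of_le hc0.le]
    exact setIntegral_mono_set hint (ae_of_all _ hnn)
      (Set.Ioc_subset_Ioi_self).eventuallyLE
  calc _ ≤ (∫ u in (0 : ℝ)..1, Real.exp 1 * (u ^ (2 * m) * Real.exp (-(c * u) ^ 2)))
        * c ^ (2 * m + 1) := by gcongr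
    _ = Real.exp 1 * ∫ v in (0 : ℝ)..c, v ^ (2 * m) * Real.exp (-v ^ 2) := by
        rw [intervalIntegral.integral_const_mul, mul_assoc, h2]
    _ ≤ _ := by gcongr

/-- Integrates the derivative of `u^{2m+1} exp(-w u²)` over `[0, 1]`. Each use splits off an
exponential term and raises the moment by one. -/
theorem gaussMoment_rec (m : ℕ) (w : ℝ) :
    (2 * m + 1) * gaussMoment m w = Real.exp (-w) + 2 * w * gaussMoment (m + 1) w := by
  have hd : ∀ u ∈ Set.uIcc (0 : ℝ) 1,
      HasDerivAt (fun u : ℝ => u ^ (2 * m + 1) * Real.exp (-w * u ^ 2))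
        ((2 * m + 1) * (u ^ (2 * m) * Real.exp (-w * u ^ 2))
          - 2 * w * (u ^ (2 * (m + 1)) * Real.exp (-w * u ^ 2))) u := by
    intro u _
    have h1 : HasDerivAt (fun u : ℝ => u ^ (2 * m + 1)) (((2 * m + 1 : ℕ) : ℝ) * u ^ (2 * m)) u :=
      hasDerivAt_pow (2 * m + 1) u
    have h2 : HasDerivAt (fun u : ℝ => Real.exp (-w * u ^ 2))
        (Real.exp (-w * u ^ 2) * (-w * (((2 : ℕ) : ℝ) * u ^ 1))) u :=
      ((hasDerivAt_pow 2 u).const_mul (-w)).exp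
    refine (h1.mul h2).congr_deriv ?_
    push_cast
    ring
  have h := intervalIntegral.integral_eq_sub_of_hasDerivAt hd
    (Continuous.intervalIntegrable (by fun_prop) _ _)
  rw [intervalIntegral.integral_sub (Continuous.intervalIntegrable (by fun_prop) _ _)
    (Continuous.intervalIntegrable (by fun_prop) _ _), intervalIntegral.integral_const_mul,
    intervalIntegral.integral_const_mul] at h
  simp only [one_pow, mul_one, one_mul, ne_eq, Nat.add_eq_zero_iff, one_ne_zero, and_false,
    not_false_eq_true, zero_pow, zero_mul, sub_zero] at h
  unfold gaussMoment
  linarith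

theorem gaussMoment_zero_right (m : ℕ) : gaussMoment m 0 = 1 / (2 * m + 1) := by
  have h := gaussMoment_rec m 0
  rw [neg_zero, Real.exp_zero] at h
  rw [eq_div_iff (by positivity)]
  linarith

theorem erf_eq_gaussMoment (t : ℝ) : erf t = 2 / √Real.pi * (t * gaussMoment 0 (t ^ 2)) := by
  unfold erf gaussMoment
  have := intervalIntegral.mul_integral_comp_mul_left (a := 0) (b := 1) (c := t)
    (f := fun v : ℝ => Real.exp (-v ^ 2))
  rw [mul_zero, mul_one] at this
  rw [← this]
  congr 2
  refine intervalIntegral.integral_congr fun u _ => ?_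
  simp [mul_pow]

/-- The coefficient of the Gauss moment in `σ_p`. -/
noncomputable def momentCoeff : ℕ → ℝ
  | 0 => 1
  | 1 => 2
  | _ => 4 / 3

/-- The smooth function `S` with `σ_p(t) = t^{2p+1} S(t²)`. -/
noncomputable def sigmaKernel (p n : ℕ) (a : ℕ → ℝ) (w : ℝ) : ℝ :=
  2 / √Real.pi * (momentCoeff p * gaussMoment p w
    + ∑ ℓ ∈ Finset.Icc 1 n, a ℓ * (w ^ (ℓ - 1) * Real.exp (-w)))

/-- `erf` is `t` times the zeroth moment at `t²`, and `p` uses of the recursion produce `t^{2p+1}`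
times the `p`-th moment plus exponential terms. The polynomials `-t` and `-t - (2/3)t³` cancel
precisely these terms, leaving the coefficients 1, 2, 4/3. -/
theorem sigma_eq_sigmaKernel {p : ℕ} (hp : p ≤ 2) (n : ℕ) (a : ℕ → ℝ) (t : ℝ) :
    sigma p n a t = t ^ (2 * p + 1) * sigmaKernel p n a (t ^ 2) := by
  have h0 := gaussMoment_rec 0 (t ^ 2)
  have h1 := gaussMoment_rec 1 (t ^ 2)
  have hsum : t ^ (2 * p) * ∑ ℓ ∈ Finset.Icc 1 n, a ℓ * t ^ (2 * ℓ - 1)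
      = t ^ (2 * p + 1) * ∑ ℓ ∈ Finset.Icc 1 n, a ℓ * (t ^ 2) ^ (ℓ - 1) := by
    rw [Finset.mul_sum, Finset.mul_sum]
    refine Finset.sum_congr rfl fun ℓ hℓ => ?_
    obtain ⟨j, rfl⟩ := Nat.exists_eq_add_of_le (Finset.mem_Icc.1 hℓ).1
    rw [show 2 * (1 + j) - 1 = 2 * j + 1 by omega, Nat.add_sub_cancel_left, ← pow_mul]
    ring
  have hsum' : ∑ ℓ ∈ Finset.Icc 1 n, a ℓ * ((t ^ 2) ^ (ℓ - 1) * Real.exp (-t ^ 2))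
      = (∑ ℓ ∈ Finset.Icc 1 n, a ℓ * (t ^ 2) ^ (ℓ - 1)) * Real.exp (-t ^ 2) := by
    rw [Finset.sum_mul]
    exact Finset.sum_congr rfl fun ℓ _ => by ring
  unfold sigma regPoly sigmaKernel
  rw [hsum, hsum', erf_eq_gaussMoment]
  set c₁ := ∑ ℓ ∈ Finset.Icc 1 n, a ℓ * (t ^ 2) ^ (ℓ - 1)
  have key : ∀ c : ℝ, t * gaussMoment 0 (t ^ 2) + Real.exp (-t ^ 2) * c
      = t ^ (2 * p + 1) * (momentCoeff p * gaussMoment p (t ^ 2)) →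
      2 / √Real.pi * (t * gaussMoment 0 (t ^ 2))
        + 2 / √Real.pi * Real.exp (-t ^ 2) * (t ^ (2 * p + 1) * c₁ + c)
      = t ^ (2 * p + 1) * (2 / √Real.pi * (momentCoeff p * gaussMoment p (t ^ 2)
        + c₁ * Real.exp (-t ^ 2))) := by
    intro c hc
    linear_combination (2 / √Real.pi) * hc
  apply key
  simp only [CharP.cast_eq_zero, mul_zero, zero_add, one_mul, Nat.cast_one, mul_one,
    Nat.reduceAdd] at h0 h1
  interval_cases p
  · simp [momentCoeff]
  · simp only [momentCoeff]
    linear_combination t * h0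
  · simp only [momentCoeff]
    linear_combination t * h0 + (2 / 3) * t ^ 3 * h1

theorem sigmaRatio_eq_sigmaKernel {p : ℕ} (hp : p ≤ 2) (n : ℕ) (a : ℕ → ℝ) {δ : ℝ} (hδ : 0 < δ)
    (r : ℝ) : sigmaRatio p n a δ r
      = (δ ^ (2 * p + 1))⁻¹ * sigmaKernel p n a ((δ ^ 2)⁻¹ * r ^ 2) := by
  unfold sigmaRatio
  split_ifs with hr
  · subst hr
    rw [zero_pow two_ne_zero, mul_zero, div_eq_inv_mul]
    congr 1
    unfold sigmaLimit sigmaKernel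
    rw [gaussMoment_zero_right]
    congr 2
    · interval_cases p <;> norm_num [momentCoeff]
    · split_ifs with hn
      -- At `w = 0` only `ℓ = 1` survives, because `0 ^ 0 = 1`.
      · rw [Finset.sum_eq_single_of_mem 1 (Finset.mem_Icc.2 ⟨le_rfl, hn⟩)]
        · simp
        · intro ℓ hℓ hne
          have := (Finset.mem_Icc.1 hℓ).1
          rw [zero_pow (by omega)]
          simp
      · rw [Finset.Icc_eq_empty hn, Finset.sum_empty]
  · rw [sigma_eq_sigmaKernel hp, div_pow, div_pow, inv_mul_eq_div]
    field_simp

theorem contDiff_pow_mul_exp_neg (j : ℕ) :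
    ContDiff ℝ ∞ fun w : ℝ => w ^ j * Real.exp (-w) := by fun_prop

/-- A derivative of `w^j e^{-w}` is a combination of functions of the same type, and these decay
faster than any power. The induction therefore runs over all `j` at once. -/
theorem exists_iteratedDeriv_pow_mul_exp_neg_le (i j N : ℕ) : ∃ C : ℝ, 0 ≤ C ∧ ∀ w : ℝ, 0 ≤ w →
    |iteratedDeriv i (fun w : ℝ => w ^ j * Real.exp (-w)) w| * √(1 + w) ^ N ≤ C := by
  induction i generalizing j with
  | zero =>
    refine ⟨(j + N).factorial * Real.exp 1, by positivity, fun w hw => ?_⟩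
    have h1 : 1 ≤ 1 + w := by linarith
    have hs : √(1 + w) ≤ 1 + w := by
      rw [Real.sqrt_le_left (by linarith)]; nlinarith
    have hexp := Real.pow_div_factorial_le_exp (x := 1 + w) (by linarith) (j + N)
    rw [div_le_iff₀ (by positivity)] at hexp
    rw [iteratedDeriv_zero, abs_of_nonneg (by positivity)]
    calc w ^ j * Real.exp (-w) * √(1 + w) ^ N
        ≤ (1 + w) ^ j * Real.exp (-w) * (1 + w) ^ N := by gcongr; linarith
      _ = (1 + w) ^ (j + N) * Real.exp (-w) := by ring
      _ ≤ Real.exp (1 + w) * (j + N).factorial * Real.exp (-w) := by gcongr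
      _ = (j + N).factorial * (Real.exp (1 + w) * Real.exp (-w)) := by ring
      _ = _ := by rw [← Real.exp_add]; congr 2; ring
  | succ i ih =>
    -- At `j = 0` the truncated `j - 1` is harmless, since its term carries the coefficient `j`.
    obtain ⟨C₁, hC₁, h₁⟩ := ih (j - 1)
    obtain ⟨C₂, hC₂, h₂⟩ := ih j
    refine ⟨j * C₁ + C₂, by positivity, fun w hw => ?_⟩
    have hd : deriv (fun w : ℝ => w ^ j * Real.exp (-w))
        = fun w => (j : ℝ) * (w ^ (j - 1) * Real.exp (-w)) - w ^ j * Real.exp (-w) := by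
      funext w
      have h2 : HasDerivAt (fun w : ℝ => Real.exp (-w)) (Real.exp (-w) * -1) w :=
        (hasDerivAt_neg w).exp
      have hm : HasDerivAt (fun w : ℝ => w ^ j * Real.exp (-w)) _ w :=
        (hasDerivAt_pow j w).mul h2
      rw [hm.deriv]
      ring
    rw [iteratedDeriv_succ', hd, iteratedDeriv_fun_sub
      ((contDiff_const.mul (contDiff_pow_mul_exp_neg _)).contDiffAt.of_le
        (by exact_mod_cast le_top))
      ((contDiff_pow_mul_exp_neg j).contDiffAt.of_le (by exact_mod_cast le_top)),
      iteratedDeriv_const_mul_field]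
    have hs : 0 ≤ √(1 + w) ^ N := by positivity
    calc _ ≤ (j * |iteratedDeriv i (fun w : ℝ => w ^ (j - 1) * Real.exp (-w)) w|
          + |iteratedDeriv i (fun w : ℝ => w ^ j * Real.exp (-w)) w|) * √(1 + w) ^ N := by
          gcongr
          refine (abs_sub _ _).trans ?_
          rw [abs_mul, Nat.abs_cast]
      _ = j * (|iteratedDeriv i (fun w : ℝ => w ^ (j - 1) * Real.exp (-w)) w| * √(1 + w) ^ N)
          + |iteratedDeriv i (fun w : ℝ => w ^ j * Real.exp (-w)) w| * √(1 + w) ^ N := by ring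
      _ ≤ _ := by gcongr; exacts [h₁ w hw, h₂ w hw]

theorem contDiff_sigmaKernel (p n : ℕ) (a : ℕ → ℝ) : ContDiff ℝ ∞ (sigmaKernel p n a) := by
  unfold sigmaKernel
  exact contDiff_const.mul ((contDiff_const.mul (contDiff_gaussMoment p)).add
    (ContDiff.sum fun ℓ _ => contDiff_const.mul (contDiff_pow_mul_exp_neg (ℓ - 1))))

theorem iteratedDeriv_sigmaKernel (i p n : ℕ) (a : ℕ → ℝ) (w : ℝ) :
    iteratedDeriv i (sigmaKernel p n a) w = 2 / √Real.pi *
      (momentCoeff p * ((-1) ^ i * gaussMoment (p + i) w) + ∑ ℓ ∈ Finset.Icc 1 n,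
        a ℓ * iteratedDeriv i (fun w : ℝ => w ^ (ℓ - 1) * Real.exp (-w)) w) := by
  have hle : (i : WithTop ℕ∞) ≤ ∞ := by exact_mod_cast le_top
  unfold sigmaKernel
  rw [iteratedDeriv_const_mul_field, iteratedDeriv_fun_add, iteratedDeriv_const_mul_field,
    iteratedDeriv_gaussMoment, iteratedDeriv_fun_sum]
  · simp_rw [iteratedDeriv_const_mul_field]
  · exact fun ℓ _ => (contDiff_const.mul (contDiff_pow_mul_exp_neg (ℓ - 1))).contDiffAt.of_le hle
  · exact (contDiff_const.mul (contDiff_gaussMoment p)).contDiffAt.of_le hle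
  · exact (ContDiff.sum fun ℓ _ =>
      contDiff_const.mul (contDiff_pow_mul_exp_neg (ℓ - 1))).contDiffAt.of_le hle

/-- Uniform decay of the derivatives of the regularized kernels. -/
theorem exists_iteratedDeriv_sigmaKernel_le (i p n : ℕ) (A : ℝ) : ∃ C : ℝ, 0 ≤ C ∧
    ∀ a : ℕ → ℝ, (∀ ℓ ∈ Finset.Icc 1 n, |a ℓ| ≤ A) → ∀ w : ℝ, 0 ≤ w →
      |iteratedDeriv i (sigmaKernel p n a) w| * √(1 + w) ^ (2 * i + 2 * p + 1) ≤ C := by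
  obtain ⟨C₁, hC₁, h₁⟩ := exists_gaussMoment_mul_le (p + i)
  choose C₂ hC₂ h₂ using fun ℓ : ℕ =>
    exists_iteratedDeriv_pow_mul_exp_neg_le i (ℓ - 1) (2 * i + 2 * p + 1)
  refine ⟨2 / √Real.pi * (|momentCoeff p| * C₁ + ∑ ℓ ∈ Finset.Icc 1 n, |A| * C₂ ℓ), ?_, ?_⟩
  · have : 0 ≤ ∑ ℓ ∈ Finset.Icc 1 n, |A| * C₂ ℓ :=
      Finset.sum_nonneg fun ℓ _ => mul_nonneg (abs_nonneg _) (hC₂ ℓ)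
    positivity
  intro a ha w hw
  rw [iteratedDeriv_sigmaKernel, abs_mul, abs_of_nonneg (by positivity : 0 ≤ 2 / √Real.pi),
    mul_assoc]
  refine mul_le_mul_of_nonneg_left ?_ (by positivity)
  set s := √(1 + w) ^ (2 * i + 2 * p + 1) with hs
  have hs0 : 0 ≤ s := by positivity
  refine (mul_le_mul_of_nonneg_right (abs_add_le _ _) hs0).trans ?_
  rw [add_mul]
  refine add_le_add ?_ ?_
  · rw [abs_mul, abs_mul, abs_pow, abs_neg, abs_one, one_pow, one_mul,
      abs_of_nonneg (gaussMoment_nonneg _ _), mul_assoc]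
    gcongr
    have := h₁ w hw
    rwa [show 2 * (p + i) + 1 = 2 * i + 2 * p + 1 by ring] at this
  · refine (mul_le_mul_of_nonneg_right (Finset.abs_sum_le_sum_abs _ _) hs0).trans ?_
    rw [Finset.sum_mul]
    refine Finset.sum_le_sum fun ℓ hℓ => ?_
    rw [abs_mul, mul_assoc]
    exact mul_le_mul ((ha ℓ hℓ).trans (le_abs_self A)) (h₂ ℓ w hw) (by positivity) (abs_nonneg _)

/-! ### The oscillating factor -/

/-- The imaginary quaternion with given components. -/
noncomputable def imQuaternion (y : E3) : Quaternion ℝ := ⟨0, y 0, y 1, y 2⟩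

@[simp]
theorem re_imQuaternion (y : E3) : (imQuaternion y).re = 0 := rfl

theorem contDiff_imQuaternion : ContDiff ℝ ∞ imQuaternion := by
  have h : imQuaternion = fun y : E3 => Quaternion.linearIsometryEquivTuple.symm
      (WithLp.toLp 2 ![0, y 0, y 1, y 2]) := by
    funext y
    rfl
  rw [h]
  refine Quaternion.linearIsometryEquivTuple.symm.contDiff.comp ?_
  refine contDiff_euclidean.2 fun i => ?_
  fin_cases i <;> simp <;> fun_prop

theorem norm_imQuaternion (y : E3) : ‖imQuaternion y‖ = ‖y‖ := by
  refine (sq_eq_sq₀ (norm_nonneg _) (norm_nonneg _)).1 ?_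
  rw [EuclideanSpace.norm_sq_eq, sq, ← Quaternion.normSq_eq_norm_mul_self, Quaternion.normSq_def',
    Fin.sum_univ_three]
  simp [imQuaternion]

theorem exp_imQuaternion (y : E3) : NormedSpace.exp (imQuaternion y)
    = ↑(Real.cos ‖y‖) + (Real.sin ‖y‖ / ‖y‖) • imQuaternion y := by
  rw [Quaternion.exp_of_re_eq_zero _ rfl, norm_imQuaternion]

/-- Although `|y|` is singular at the origin, `cos |y|` and `|y| sin |y|` are inner products of this
exponential with `1` and with `y` itself, so analyticity of the exponential gives their smoothness.
-/
theorem contDiff_exp_imQuaternion :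
    ContDiff ℝ ∞ fun y : E3 => NormedSpace.exp (imQuaternion y) := by
  have h : ContDiff ℝ ∞ (NormedSpace.exp : Quaternion ℝ → Quaternion ℝ) :=
    contDiff_iff_contDiffAt.2 fun q => (NormedSpace.exp_analytic (𝕂 := ℝ) q).contDiffAt
  exact h.comp contDiff_imQuaternion

theorem contDiff_cos_norm : ContDiff ℝ ∞ fun y : E3 => Real.cos ‖y‖ := by
  have h : (fun y : E3 => Real.cos ‖y‖)
      = fun y => (inner ℝ (NormedSpace.exp (imQuaternion y)) 1 : ℝ) := by
    funext y
    rw [exp_imQuaternion, Quaternion.inner_def]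
    simp
  rw [h]
  exact contDiff_exp_imQuaternion.inner ℝ contDiff_const

theorem contDiff_norm_mul_sin_norm : ContDiff ℝ ∞ fun y : E3 => ‖y‖ * Real.sin ‖y‖ := by
  have h : (fun y : E3 => ‖y‖ * Real.sin ‖y‖)
      = fun y => (inner ℝ (NormedSpace.exp (imQuaternion y)) (imQuaternion y) : ℝ) := by
    funext y
    have h0 : (inner ℝ ((Real.cos ‖y‖ : ℝ) : Quaternion ℝ) (imQuaternion y) : ℝ) = 0 := by
      rw [Quaternion.inner_def]
      simp
    rw [exp_imQuaternion, inner_add_left, h0, zero_add, real_inner_smul_left,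
      real_inner_self_eq_norm_sq, norm_imQuaternion]
    rcases eq_or_ne ‖y‖ 0 with hy | hy
    · simp [hy]
    · field_simp
  rw [h]
  exact contDiff_exp_imQuaternion.inner ℝ contDiff_imQuaternion

theorem LayerOp.contDiff_Phi_norm (B : LayerOp) {k : ℝ} (hk : 0 < k) :
    ContDiff ℝ ∞ fun y : E3 => B.Phi (k * ‖y‖) := by
  have hn : ∀ y : E3, k * ‖y‖ = ‖k • y‖ := fun y => by
    rw [norm_smul, Real.norm_of_nonneg hk.le]
  have hs : ContDiff ℝ ∞ fun y : E3 => k • y := contDiff_const_smul k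
  have hc := contDiff_cos_norm.comp hs
  have hi := contDiff_norm_mul_sin_norm.comp hs
  have hq : ContDiff ℝ ∞ fun y : E3 => ‖k • y‖ ^ 2 := hs.norm_sq ℝ
  simp only [hn]
  cases B
  · exact hc
  · exact hc.add hi
  · exact hc.add hi
  · exact hc.add hi
  · have := ((hq.sub (contDiff_const (c := (3 : ℝ)))).mul hc).sub
      ((contDiff_const (c := (3 : ℝ))).mul hi)
    simp only [LayerOp.Phi, mul_assoc]
    exact this


/-! ### Derivative bounds for the parametrization and the Jacobian -/

theorem JetFrame.Bounded.of_forall {κ E V : Type*} [NormedAddCommGroup E] [NormedSpace ℝ E]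
    [NormedAddCommGroup V] [NormedSpace ℝ V] {J : JetFrame κ E} {f : κ → E → V} {b : κ → ℝ}
    (hb : ∀ a, 0 ≤ b a) (hf : ∀ a, ContDiffOn ℝ J.order (f a) J.dom)
    (h : ∀ i ≤ J.order, ∃ K : ℝ, ∀ a,
      ‖iteratedFDerivWithin ℝ i (f a) J.dom (J.pt a)‖ ≤ K * b a * J.scale a ^ i) :
    J.Bounded f b := by
  have h' : ∀ i, ∃ K : ℝ, i ≤ J.order → ∀ a,
      ‖iteratedFDerivWithin ℝ i (f a) J.dom (J.pt a)‖ ≤ K * b a * J.scale a ^ i := by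
    intro i
    by_cases hi : i ≤ J.order
    · obtain ⟨K, hK⟩ := h i hi
      exact ⟨K, fun _ => hK⟩
    · exact ⟨0, fun h => absurd h hi⟩
  choose K hK using h'
  refine ⟨∑ i ∈ Finset.range (J.order + 1), |K i|, 1, Finset.sum_nonneg fun _ _ => abs_nonneg _,
    le_rfl, fun a => ⟨hf a, fun i hi => (hK i hi a).trans ?_⟩⟩
  have h0 := J.scale_nonneg a
  have h1 := hb a
  rw [one_mul]
  gcongr
  exact (le_abs_self _).trans (Finset.single_le_sum (f := fun i => |K i|)
    (fun _ _ => abs_nonneg _) (Finset.mem_range.2 (Nat.lt_succ_of_le hi)))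

/-- The cross product as a continuous bilinear map. -/
noncomputable def crossCLM : E3 →L[ℝ] E3 →L[ℝ] E3 :=
  LinearMap.toContinuousBilinearMap (LinearMap.mk₂ ℝ
    (fun u v : E3 => (WithLp.toLp 2 (u.ofLp ⨯₃ v.ofLp) : E3))
    (fun u u' v => by simp) (fun c u v => by simp) (fun u v v' => by simp)
    (fun c u v => by simp))

namespace ClosedSurface

variable (Γ : ClosedSurface)

theorem contDiff_gradient : ContDiff ℝ ∞ (gradient Γ.defFun) := by
  have h : ContDiff ℝ ∞ (fderiv ℝ Γ.defFun) := Γ.smooth.fderiv_right (by simp)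
  exact (InnerProductSpace.toDual ℝ E3).symm.contDiff.comp h

/-- The open set on which the normal is smooth. -/
def regularSet : Set E3 := {y | gradient Γ.defFun y ≠ 0}

theorem isOpen_regularSet : IsOpen Γ.regularSet :=
  isOpen_compl_singleton.preimage Γ.contDiff_gradient.continuous

theorem carrier_subset_regularSet : Γ.carrier ⊆ Γ.regularSet := Γ.regular

theorem contDiffOn_normal : ContDiffOn ℝ ∞ Γ.normal Γ.regularSet := by
  have hg : ContDiffOn ℝ ∞ (gradient Γ.defFun) Γ.regularSet := Γ.contDiff_gradient.contDiffOn
  have hn : ContDiffOn ℝ ∞ (fun y => ‖gradient Γ.defFun y‖) Γ.regularSet :=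
    hg.norm ℝ fun y hy => hy
  exact (hn.inv fun y hy => norm_ne_zero_iff.2 hy).smul hg

theorem norm_normal {x : E3} (hx : x ∈ Γ.carrier) : ‖Γ.normal x‖ = 1 :=
  norm_smul_inv_norm (𝕜 := ℝ) (Γ.regular x hx)

end ClosedSurface

namespace SurfaceMesh

variable {Γ : ClosedSurface} {That : ReferenceElement} (M : SurfaceMesh Γ That)

theorem mapsTo_param (T : Fin M.card) : Set.MapsTo (M.param T) That.carrier Γ.carrier := by
  intro z hz
  rw [← M.covers]
  exact Set.mem_iUnion.2 ⟨T, z, hz, rfl⟩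

theorem isCompact_element (T : Fin M.card) : IsCompact (M.param T '' That.carrier) :=
  That.compact.image_of_continuousOn (M.smooth T).continuousOn

theorem elementDiam_pos (T : Fin M.card) : 0 < M.elementDiam T := by
  refine Metric.diam_pos ?_ (M.isCompact_element T).isBounded
  obtain ⟨z, hz⟩ := That.interior_nonempty
  have hnt : (interior That.carrier).Nontrivial :=
    (infinite_of_mem_nhds z (isOpen_interior.mem_nhds hz)).nontrivial
  exact (hnt.image_of_injOn (M.injOn T)).mono (Set.image_mono interior_subset)

theorem elementDiam_le_size (T : Fin M.card) : M.elementDiam T ≤ M.size :=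
  le_ciSup (f := fun T => M.elementDiam T) (Set.finite_range _).bddAbove T

theorem norm_sub_le_elementDiam (T : Fin M.card) {z z' : E2} (hz : z ∈ That.carrier)
    (hz' : z' ∈ That.carrier) : ‖M.param T z - M.param T z'‖ ≤ M.elementDiam T := by
  rw [← dist_eq_norm]
  exact Metric.dist_le_diam_of_mem (M.isCompact_element T).isBounded ⟨z, hz, rfl⟩ ⟨z', hz', rfl⟩

end SurfaceMesh

/-- All the data on which the integrand depends on one element of a mesh. -/
structure ErrorData {ι : Type*} {Γ : ClosedSurface} {That : ReferenceElement}
    (mesh : ι → SurfaceMesh Γ That) (q n : ℕ) (A : ℝ) where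
  i : ι
  T : Fin (mesh i).card
  x : E3
  x_mem : x ∈ Γ.carrier
  δ : ℝ
  δ_pos : 0 < δ
  δ_lt : δ < 1
  a : ℕ → ℝ
  a_le : ∀ ℓ ∈ Finset.Icc 1 n, |a ℓ| ≤ A
  g : E3 → ℂ
  g_smooth : ContDiff ℝ (q + 1 : ℕ) g
  M : ℝ
  M_nonneg : 0 ≤ M
  g_le : ∀ j ≤ q + 1, ∀ y ∈ Γ.carrier, ‖iteratedFDeriv ℝ j g y‖ ≤ M
  z : E2
  z_mem : z ∈ That.carrier

namespace ErrorData

variable {ι : Type*} {Γ : ClosedSurface} {That : ReferenceElement}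
  {mesh : ι → SurfaceMesh Γ That} {q n : ℕ} {A : ℝ} (e : ErrorData mesh q n A)

/-- The parametrization of the element. -/
def F : E2 → E3 := (mesh e.i).param e.T

/-- The diameter of the element. -/
noncomputable def h : ℝ := (mesh e.i).elementDiam e.T

/-- The regularized distance from the singularity. -/
noncomputable def dist : ℝ := e.δ + ‖e.F e.z - e.x‖

theorem h_pos : 0 < e.h := (mesh e.i).elementDiam_pos e.T

theorem δ_le_dist : e.δ ≤ e.dist := le_add_of_nonneg_right (norm_nonneg _)

theorem dist_pos : 0 < e.dist := e.δ_pos.trans_le e.δ_le_dist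

theorem mapsTo_F : Set.MapsTo e.F That.carrier Γ.carrier := (mesh e.i).mapsTo_param e.T

theorem F_smooth : ContDiffOn ℝ ∞ e.F That.carrier := (mesh e.i).smooth e.T

variable (mesh q n A) in
/-- The frame in which all derivatives are measured: the element, up to the order `q + 1`, at the
scale `dist / h`. -/
noncomputable def frame : JetFrame (ErrorData mesh q n A) E2 where
  dom := That.carrier
  order := q + 1
  pt := z
  scale e := e.h / e.dist
  uniqueDiffOn := That.uniqueDiffOn
  pt_mem := z_mem
  scale_nonneg e := div_nonneg e.h_pos.le e.dist_pos.le

variable (Γ) in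
-- Shape regularity yields plain powers `h^i`, while the frame asks for `(h/ρ)^i`. A bound on `ρ`
-- depending only on `Γ` absorbs the difference.
theorem exists_dist_le : ∃ P : ℝ, 1 ≤ P ∧ ∀ {ι : Type*} {That : ReferenceElement}
    {mesh : ι → SurfaceMesh Γ That} {q n : ℕ} {A : ℝ} (e : ErrorData mesh q n A), e.dist ≤ P := by
  obtain ⟨R, hR, h⟩ := Γ.exists_dist_le
  refine ⟨R + 1, by linarith, fun e => ?_⟩
  have := h e.x e.x_mem _ (e.mapsTo_F e.z_mem)
  have := e.δ_lt
  unfold ErrorData.dist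
  linarith

theorem contDiffOn_order {E V : Type*} [NormedAddCommGroup E] [NormedSpace ℝ E]
    [NormedAddCommGroup V] [NormedSpace ℝ V] {f : E → V} {s : Set E} (hf : ContDiffOn ℝ ∞ f s) : ContDiffOn ℝ (frame mesh q n A).order f s :=
  hf.of_le (by exact_mod_cast le_top)

/-- For order zero `|F - x| ≤ ρ` by definition of `ρ`. For `i ≥ 1`, `h^i = ρ^{i-1} · ρ · (h/ρ)^i`,
and the surplus power of `ρ` is bounded. -/
theorem bounded_param_sub (hmesh : ShapeRegular mesh) :
    (frame mesh q n A).Bounded (fun e y => e.F y - e.x) fun e => e.dist := by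
  obtain ⟨P, hP, hdist⟩ := exists_dist_le Γ
  refine JetFrame.Bounded.of_forall (fun e => e.dist_pos.le)
    (fun e => contDiffOn_order (e.F_smooth.sub contDiffOn_const)) fun i hi => ?_
  rcases Nat.eq_zero_or_pos i with rfl | hpos
  · refine ⟨1, fun e => ?_⟩
    have : ‖e.F e.z - e.x‖ ≤ e.dist := le_add_of_nonneg_left e.δ_pos.le
    rw [norm_iteratedFDerivWithin_zero, one_mul, pow_zero, mul_one]
    exact this
  · obtain ⟨C, hC⟩ := hmesh.1 i hpos
    refine ⟨|C| * P ^ i, fun e => ?_⟩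
    have hd := e.dist_pos
    have hh := e.h_pos
    have hsub : iteratedFDerivWithin ℝ i (fun y => e.F y - e.x) That.carrier e.z
        = iteratedFDerivWithin ℝ i e.F That.carrier e.z := by
      change iteratedFDerivWithin ℝ i (e.F - fun _ => e.x) That.carrier e.z = _
      rw [iteratedFDerivWithin_sub_apply
        ((e.F_smooth.of_le (by exact_mod_cast le_top)) _ e.z_mem) contDiffWithinAt_const
        That.uniqueDiffOn e.z_mem, iteratedFDerivWithin_const_of_ne hpos.ne']
      simp
    change ‖iteratedFDerivWithin ℝ i (fun y => e.F y - e.x) That.carrier e.z‖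
      ≤ |C| * P ^ i * e.dist * (e.h / e.dist) ^ i
    rw [hsub]
    refine (hC e.i e.T e.z e.z_mem).trans ?_
    obtain ⟨j, rfl⟩ := Nat.exists_eq_succ_of_ne_zero hpos.ne'
    have hPj : e.dist ^ j ≤ P ^ (j + 1) :=
      (pow_le_pow_left₀ hd.le (hdist e) j).trans (pow_le_pow_right₀ hP (Nat.le_succ j))
    calc C * e.h ^ (j + 1) ≤ |C| * e.h ^ (j + 1) := by gcongr; exact le_abs_self C
      _ = |C| * e.dist ^ j * e.dist * (e.h / e.dist) ^ (j + 1) := by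
          rw [div_pow]; field_simp; ring
      _ ≤ _ := by gcongr

theorem bounded_param_sub_one (hmesh : ShapeRegular mesh) :
    (frame mesh q n A).Bounded (fun e y => e.F y - e.x) fun _ => 1 := by
  obtain ⟨P, hP, hdist⟩ := exists_dist_le Γ
  exact (bounded_param_sub hmesh).mono (K := P) (by linarith) fun e => by simpa using hdist e

theorem bounded_param (hmesh : ShapeRegular mesh) :
    (frame mesh q n A).Bounded (fun e y => e.F y) fun _ => 1 := by
  obtain ⟨P, hP, hdist⟩ := exists_dist_le Γ
  obtain ⟨R, hR⟩ := Γ.isCompact_carrier.isBounded.exists_norm_le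
  refine JetFrame.Bounded.of_forall (fun _ => zero_le_one)
    (fun e => contDiffOn_order e.F_smooth) fun i hi => ?_
  rcases Nat.eq_zero_or_pos i with rfl | hpos
  · refine ⟨R, fun e => ?_⟩
    simpa [frame] using hR _ (e.mapsTo_F e.z_mem)
  · obtain ⟨C, hC⟩ := hmesh.1 i hpos
    refine ⟨|C| * P ^ i, fun e => (hC e.i e.T e.z e.z_mem).trans ?_⟩
    have hd := e.dist_pos
    have hh := e.h_pos
    calc C * e.h ^ i ≤ |C| * e.h ^ i := by gcongr; exact le_abs_self C
      _ = |C| * e.dist ^ i * 1 * (e.h / e.dist) ^ i := by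
          rw [div_pow]; field_simp
      _ ≤ |C| * P ^ i * 1 * (e.h / e.dist) ^ i := by gcongr; exact hdist e

theorem bounded_tangent (hmesh : ShapeRegular mesh) (v : E2) :
    (frame mesh q n A).Bounded (fun e y => fderivWithin ℝ e.F That.carrier y v) fun e => e.h := by
  obtain ⟨P, hP, hdist⟩ := exists_dist_le Γ
  have hsm : ∀ e : ErrorData mesh q n A, ContDiffOn ℝ ∞ (fderivWithin ℝ e.F That.carrier)
      That.carrier := fun e => e.F_smooth.fderivWithin That.uniqueDiffOn (by simp)
  refine JetFrame.Bounded.of_forall (fun e => e.h_pos.le)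
    (fun e => contDiffOn_order ((hsm e).clm_apply contDiffOn_const)) fun i hi => ?_
  obtain ⟨C, hC⟩ := hmesh.1 (i + 1) (Nat.le_add_left 1 i)
  refine ⟨‖v‖ * (|C| * P ^ i), fun e => ?_⟩
  have hd := e.dist_pos
  have hh := e.h_pos
  have h1 := norm_iteratedFDerivWithin_clm_apply_const (c := v) (n := i) (N := ∞)
    ((hsm e) _ e.z_mem) That.uniqueDiffOn e.z_mem (by exact_mod_cast le_top)
  rw [norm_iteratedFDerivWithin_fderivWithin That.uniqueDiffOn e.z_mem] at h1
  refine h1.trans ?_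
  rw [mul_assoc ‖v‖, mul_assoc ‖v‖]
  refine mul_le_mul_of_nonneg_left ((hC e.i e.T e.z e.z_mem).trans ?_) (norm_nonneg v)
  calc C * e.h ^ (i + 1) ≤ |C| * e.h ^ (i + 1) := by gcongr; exact le_abs_self C
    _ = |C| * e.dist ^ i * e.h * (e.h / e.dist) ^ i := by
        rw [div_pow]; field_simp; ring
    _ ≤ |C| * P ^ i * e.h * (e.h / e.dist) ^ i := by gcongr; exact hdist e

/-- The norm is smooth only away from zero. After division by `h²` the cross product of the tangents
stays in a fixed annulus, by the upper derivative bounds and the lower Jacobian bound, so the norm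
can be applied as a fixed smooth function on a compact set. -/
theorem bounded_surfaceJacobian (hmesh : ShapeRegular mesh) :
    (frame mesh q n A).Bounded (fun e y => surfaceJacobian That e.F y) fun e => e.h ^ 2 := by
  obtain ⟨c, hc, hJ⟩ := hmesh.2
  have hcross := (bounded_tangent (q := q) (n := n) (A := A) hmesh
    (EuclideanSpace.single 0 1)).bilin crossCLM (fun e => e.h_pos.le) (fun e => e.h_pos.le)
    (bounded_tangent hmesh (EuclideanSpace.single 1 1))
  have hconst : (frame mesh q n A).Bounded (fun e _ => (e.h ^ 2)⁻¹) fun e => (e.h ^ 2)⁻¹ :=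
    JetFrame.bounded_const (K := 1) (fun e => by positivity) zero_le_one fun e => by
      rw [one_mul, Real.norm_of_nonneg (by positivity)]
  have hV : (frame mesh q n A).Bounded (fun e y => (e.h ^ 2)⁻¹ •
      crossCLM (fderivWithin ℝ e.F That.carrier y (EuclideanSpace.single 0 1))
        (fderivWithin ℝ e.F That.carrier y (EuclideanSpace.single 1 1))) fun _ => 1 := by
    refine (hconst.smul (fun e => by positivity)
      (fun e => mul_nonneg e.h_pos.le e.h_pos.le) hcross).mono (K := 1) zero_le_one fun e => ?_
    have := e.h_pos
    rw [← sq, inv_mul_cancel₀ (by positivity), one_mul]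
  have hVnorm : ∀ (e : ErrorData mesh q n A) (y : E2), ‖(e.h ^ 2)⁻¹ •
      crossCLM (fderivWithin ℝ e.F That.carrier y (EuclideanSpace.single 0 1))
        (fderivWithin ℝ e.F That.carrier y (EuclideanSpace.single 1 1))‖
      = (e.h ^ 2)⁻¹ * surfaceJacobian That e.F y := by
    intro e y
    rw [norm_smul, norm_inv, Real.norm_of_nonneg (by positivity)]
    rfl
  have hlow : ∀ (e : ErrorData mesh q n A), ∀ y ∈ That.carrier,
      c ≤ (e.h ^ 2)⁻¹ * surfaceJacobian That e.F y := by
    intro e y hy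
    have := e.h_pos
    rw [inv_mul_eq_div, le_div_iff₀ (by positivity)]
    exact hJ e.i e.T y hy
  obtain ⟨K, Λ, hK, hΛ, hb⟩ := id hV
  have hN := hV.comp_of_isCompact (g := fun v => ‖v‖) (t := {0}ᶜ)
    (k := Metric.closedBall 0 K ∩ {v | c ≤ ‖v‖}) isOpen_compl_singleton
    ((isCompact_closedBall _ _).inter_right (isClosed_le continuous_const continuous_norm))
    ?_ ?_ ?_ ?_
  · have hsq : (frame mesh q n A).Bounded (fun e _ => e.h ^ 2) fun e => e.h ^ 2 :=
      JetFrame.bounded_const (K := 1) (fun e => by positivity) zero_le_one fun e => by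
        rw [one_mul, Real.norm_of_nonneg (by positivity)]
    refine ((hsq.mul (fun e => by positivity) (fun _ => zero_le_one) hN).mono (K := 1)
      zero_le_one fun e => by simp).congr fun e y hy => ?_
    have := e.h_pos
    simp only [hVnorm]
    field_simp
  · rintro v ⟨-, hv⟩ rfl
    simp only [Set.mem_ofPred_eq, norm_zero] at hv
    linarith
  · intro e y hy h0
    have h1 := hlow e y hy
    rw [← hVnorm, show (e.h ^ 2)⁻¹ • crossCLM _ _ = (0 : E3) from h0, norm_zero] at h1
    linarith
  · intro e
    refine ⟨?_, ?_⟩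
    · have := (hb e).2 0 (Nat.zero_le _)
      rw [mem_closedBall_zero_iff]
      simpa using this
    · rw [Set.mem_ofPred_eq, hVnorm]
      exact hlow e e.z e.z_mem
  · intro v hv
    exact (contDiffAt_norm ℝ hv).contDiffWithinAt

end ErrorData


/-- The radial factor in terms of the squared distance `w`. -/
noncomputable def scaledKernel (p n : ℕ) (a : ℕ → ℝ) (δ w : ℝ) : ℝ :=
  (δ ^ (2 * p + 1))⁻¹ * sigmaKernel p n a ((δ ^ 2)⁻¹ * w)

theorem contDiff_scaledKernel (p n : ℕ) (a : ℕ → ℝ) (δ : ℝ) :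
    ContDiff ℝ ∞ (scaledKernel p n a δ) :=
  contDiff_const.mul ((contDiff_sigmaKernel p n a).comp (contDiff_const.mul contDiff_id))

theorem norm_iteratedFDeriv_scaledKernel (i p n : ℕ) (a : ℕ → ℝ) {δ : ℝ} (hδ : 0 < δ) (w : ℝ) :
    ‖iteratedFDeriv ℝ i (scaledKernel p n a δ) w‖
      = (δ ^ (2 * p + 1))⁻¹ * ((δ ^ 2)⁻¹ ^ i
        * |iteratedDeriv i (sigmaKernel p n a) ((δ ^ 2)⁻¹ * w)|) := by
  rw [norm_iteratedFDeriv_eq_norm_iteratedDeriv]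
  unfold scaledKernel
  rw [iteratedDeriv_const_mul_field, iteratedDeriv_comp_const_mul
    ((contDiff_sigmaKernel p n a).of_le (by exact_mod_cast le_top)), Real.norm_eq_abs, abs_mul,
    abs_mul, abs_of_nonneg (by positivity), abs_of_nonneg (by positivity)]

/-- For `w = r²/δ²` one has `δ + r ≤ 2δ√(1 + w)`, which converts decay in `1 + w` into powers of `δ
+ r`. The weight `((δ + r)²)^i` is what composition with the squared distance, varying on the scale
`ρ²`, requires. -/
theorem exists_norm_iteratedFDeriv_scaledKernel_le (i p n : ℕ) (A : ℝ) : ∃ K : ℝ, 0 ≤ K ∧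
    ∀ a : ℕ → ℝ, (∀ ℓ ∈ Finset.Icc 1 n, |a ℓ| ≤ A) → ∀ δ r : ℝ, 0 < δ → 0 ≤ r →
      ‖iteratedFDeriv ℝ i (scaledKernel p n a δ) (r ^ 2)‖ * ((δ + r) ^ 2) ^ i
        ≤ K * ((δ + r) ^ (2 * p + 1))⁻¹ := by
  obtain ⟨C, hC, h⟩ := exists_iteratedDeriv_sigmaKernel_le i p n A
  refine ⟨2 ^ (2 * i + 2 * p + 1) * C, by positivity, fun a ha δ r hδ hr => ?_⟩
  rw [norm_iteratedFDeriv_scaledKernel i p n a hδ]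
  have hw : 0 ≤ (δ ^ 2)⁻¹ * r ^ 2 := by positivity
  have hS := h a ha _ hw
  set D := |iteratedDeriv i (sigmaKernel p n a) ((δ ^ 2)⁻¹ * r ^ 2)|
  have hD : 0 ≤ D := abs_nonneg _
  have hs : (δ + r) / δ ≤ 2 * √(1 + (δ ^ 2)⁻¹ * r ^ 2) := by
    rw [← Real.sqrt_sq (by positivity : 0 ≤ (δ + r) / δ), ← Real.sqrt_sq zero_le_two,
      ← Real.sqrt_mul (by positivity)]
    refine Real.sqrt_le_sqrt ?_
    rw [div_pow, div_le_iff₀ (by positivity)]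
    field_simp
    nlinarith [sq_nonneg (δ - r)]
  have hρ : 0 < δ + r := by positivity
  calc (δ ^ (2 * p + 1))⁻¹ * ((δ ^ 2)⁻¹ ^ i * D) * ((δ + r) ^ 2) ^ i
      = D * ((δ + r) / δ) ^ (2 * i + 2 * p + 1) * ((δ + r) ^ (2 * p + 1))⁻¹ := by
        rw [show 2 * i + 2 * p + 1 = 2 * i + (2 * p + 1) by ring, div_pow, pow_add (δ + r),
          pow_add δ (2 * i), inv_pow, ← pow_mul, ← pow_mul]
        field_simp
    _ ≤ D * (2 * √(1 + (δ ^ 2)⁻¹ * r ^ 2)) ^ (2 * i + 2 * p + 1)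
        * ((δ + r) ^ (2 * p + 1))⁻¹ := by gcongr
    _ = 2 ^ (2 * i + 2 * p + 1) * (D * √(1 + (δ ^ 2)⁻¹ * r ^ 2) ^ (2 * i + 2 * p + 1))
        * ((δ + r) ^ (2 * p + 1))⁻¹ := by rw [mul_pow]; ring
    _ ≤ _ := by gcongr

theorem LayerOp.p_le_two (B : LayerOp) : B.p ≤ 2 := by cases B <;> simp [LayerOp.p]

/-- The regularized integrand for a function `g` on `ℝ³`, in terms of smooth factors. -/
theorem LayerOp.regularizedIntegrand_eq (Γ : ClosedSurface) (B : LayerOp) (k : ℝ) (n : ℕ)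
    (a : ℕ → ℝ) {δ : ℝ} (hδ : 0 < δ) (g : E3 → ℂ) (x y : E3) :
    B.regularizedIntegrand Γ k n a δ g x y
      = (B.Phi (k * ‖y - x‖) * scaledKernel B.p n a δ (‖y - x‖ ^ 2) * B.Psi Γ x y) • g y := by
  rw [regularizedIntegrand, norm_sub_rev, sigmaRatio_eq_sigmaKernel B.p_le_two n a hδ,
    Complex.real_smul]
  rfl

/-! ### Derivative bounds for the integrand on one element -/

namespace ErrorData

variable {ι : Type*} {Γ : ClosedSurface} {That : ReferenceElement}
  {mesh : ι → SurfaceMesh Γ That} {q n : ℕ} {A : ℝ}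

theorem bounded_sq (hmesh : ShapeRegular mesh) :
    (frame mesh q n A).Bounded (fun e y => ‖e.F y - e.x‖ ^ 2) fun e => e.dist ^ 2 := by
  have h := bounded_param_sub (q := q) (n := n) (A := A) hmesh
  simpa only [real_inner_self_eq_norm_sq, ← sq] using
    h.inner (fun e => e.dist_pos.le) (fun e => e.dist_pos.le) h

theorem bounded_scaledKernel (hmesh : ShapeRegular mesh) (p : ℕ) :
    (frame mesh q n A).Bounded (fun e y => scaledKernel p n e.a e.δ (‖e.F y - e.x‖ ^ 2))
      fun e => (e.dist ^ (2 * p + 1))⁻¹ := by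
  choose K hK h using fun i => exists_norm_iteratedFDeriv_scaledKernel_le i p n A
  refine (bounded_sq (q := q) (n := n) (A := A) hmesh).comp
    (g := fun e : ErrorData mesh q n A => scaledKernel p n e.a e.δ) (t := fun _ => Set.univ)
    (K := ∑ i ∈ Finset.range (q + 1 + 1), K i) (fun e => pow_pos e.dist_pos 2)
    (fun e => inv_nonneg.2 (pow_nonneg e.dist_pos.le _)) (Finset.sum_nonneg fun i _ => hK i)
    (fun _ => uniqueDiffOn_univ) (fun _ => Set.mapsTo_univ _ _)
    (fun e => contDiffOn_order (contDiff_scaledKernel p n e.a e.δ).contDiffOn) fun e i hi => ?_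
  rw [iteratedFDerivWithin_univ]
  refine (h i e.a e.a_le e.δ ‖e.F e.z - e.x‖ e.δ_pos (norm_nonneg _)).trans ?_
  have := e.dist_pos
  refine mul_le_mul_of_nonneg_right ?_ (inv_nonneg.2 (pow_nonneg e.dist_pos.le _))
  exact Finset.single_le_sum (f := K) (fun i _ => hK i)
    (Finset.mem_range.2 (Nat.lt_succ_of_le hi))

theorem bounded_Phi (hmesh : ShapeRegular mesh) (B : LayerOp) {k : ℝ} (hk : 0 < k) :
    (frame mesh q n A).Bounded (fun e y => B.Phi (k * ‖e.F y - e.x‖)) fun _ => 1 := by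
  obtain ⟨R, hR, h⟩ := Γ.exists_dist_le
  refine (bounded_param_sub_one hmesh).comp_of_isCompact (g := fun v => B.Phi (k * ‖v‖))
    isOpen_univ (isCompact_closedBall (0 : E3) R) (Set.subset_univ _)
    (fun _ => Set.mapsTo_univ _ _) (fun e => ?_)
    (contDiffOn_order (B.contDiff_Phi_norm hk).contDiffOn)
  rw [mem_closedBall_zero_iff]
  exact h e.x e.x_mem _ (e.mapsTo_F e.z_mem)

theorem bounded_normal (hmesh : ShapeRegular mesh) :
    (frame mesh q n A).Bounded (fun e y => Γ.normal (e.F y)) fun _ => 1 :=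
  (bounded_param hmesh).comp_of_isCompact Γ.isOpen_regularSet Γ.isCompact_carrier
    Γ.carrier_subset_regularSet (fun e _ hy => Γ.carrier_subset_regularSet (e.mapsTo_F hy))
    (fun e => e.mapsTo_F e.z_mem) (contDiffOn_order Γ.contDiffOn_normal)

theorem bounded_normal_const :
    (frame mesh q n A).Bounded (fun e _ => Γ.normal e.x) fun _ => 1 :=
  JetFrame.bounded_const (K := 1) (fun _ => zero_le_one) zero_le_one fun e => by
    rw [Γ.norm_normal e.x_mem, one_mul]

/-- Only for `H` is the vanishing of `Ψ` at `y = x` retained, through the factor `|x - y|²`. For the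
other operators boundedness suffices; the tangential gain in `ν(y)·(x - y)` does not enter the
rates. -/
theorem bounded_Psi (hmesh : ShapeRegular mesh) (B : LayerOp) :
    (frame mesh q n A).Bounded (fun e y => B.Psi Γ e.x (e.F y))
      fun e => e.dist ^ (2 * B.s) := by
  have h1 : ∀ _ : ErrorData mesh q n A, (0 : ℝ) ≤ 1 := fun _ => zero_le_one
  have hd := bounded_param_sub_one (q := q) (n := n) (A := A) hmesh
  have hd' : (frame mesh q n A).Bounded (fun e y => e.x - e.F y) fun _ => 1 := by
    have hc : (frame mesh q n A).Bounded (fun _ _ => (-1 : ℝ)) fun _ => 1 :=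
      JetFrame.bounded_const (K := 1) h1 zero_le_one fun _ => by simp
    simpa using hc.smul h1 h1 hd
  have hν := bounded_normal (q := q) (n := n) (A := A) hmesh
  have hν' := bounded_normal_const (mesh := mesh) (q := q) (n := n) (A := A)
  have h0 : ∀ b : ErrorData mesh q n A → ℝ, (∀ e, b e = 1) →
      ∀ e, b e ≤ 1 * e.dist ^ (2 * 0) := fun b hb e => by simp [hb e]
  cases B
  · exact JetFrame.bounded_const (K := 1) (fun e => by simp [LayerOp.s]) zero_le_one
      fun e => by
        change ‖(1 : ℝ)‖ ≤ 1 * e.dist ^ (2 * 0)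
        simp
  · exact (hν.inner h1 h1 hd').mono zero_le_one (h0 _ fun _ => by simp)
  · exact (hν'.inner h1 h1 hd).mono zero_le_one (h0 _ fun _ => by simp)
  · have hsq := bounded_sq (q := q) (n := n) (A := A) hmesh
    have hνν := hν.inner h1 h1 hν'
    refine ((hsq.mul (fun e => by positivity) (fun _ => by norm_num) hνν).mono (K := 1)
      zero_le_one fun e => by simp [LayerOp.s]).congr fun e y _ => ?_
    simp only [LayerOp.Psi, real_inner_self_eq_norm_sq]
    rw [norm_sub_rev]
  · exact ((hd'.inner h1 h1 hν).mul (fun _ => by norm_num) (fun _ => by norm_num)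
      (hd'.inner h1 h1 hν')).mono zero_le_one (h0 _ fun _ => by simp)

theorem bounded_density (hmesh : ShapeRegular mesh) :
    (frame mesh q n A).Bounded (fun e y => e.g (e.F y)) fun e => e.M := by
  refine (bounded_param (q := q) (n := n) (A := A) hmesh).comp
    (g := fun e : ErrorData mesh q n A => e.g) (t := fun _ => Set.univ) (K := 1)
    (fun _ => one_pos) (fun e => e.M_nonneg) zero_le_one
    (fun _ => uniqueDiffOn_univ) (fun _ => Set.mapsTo_univ _ _)
    (fun e => e.g_smooth.contDiffOn) fun e i hi => ?_
  rw [iteratedFDerivWithin_univ, one_pow, mul_one, one_mul]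
  exact e.g_le i hi _ (e.mapsTo_F e.z_mem)

/-- The pulled back integrand on the reference element, including the surface Jacobian. -/
noncomputable def integrand (B : LayerOp) (k : ℝ) (e : ErrorData mesh q n A) (y : E2) : ℂ :=
  surfaceJacobian That e.F y • B.regularizedIntegrand Γ k n e.a e.δ e.g e.x (e.F y)

theorem bounded_integrand (hmesh : ShapeRegular mesh) (B : LayerOp) {k : ℝ} (hk : 0 < k) :
    (frame mesh q n A).Bounded (integrand B k) fun e =>
      e.h ^ 2 * (1 * (e.dist ^ (2 * B.p + 1))⁻¹ * e.dist ^ (2 * B.s) * e.M) := by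
  have hd : ∀ e : ErrorData mesh q n A, 0 < e.dist := fun e => e.dist_pos
  have hM : ∀ e : ErrorData mesh q n A, 0 ≤ e.M := fun e => e.M_nonneg
  have hp : ∀ (e : ErrorData mesh q n A) (m : ℕ), 0 ≤ (e.dist ^ m)⁻¹ := fun e m =>
    inv_nonneg.2 (pow_nonneg (hd e).le m)
  have hs : ∀ (e : ErrorData mesh q n A) (m : ℕ), 0 ≤ e.dist ^ m := fun e m =>
    pow_nonneg (hd e).le m
  have h1 := (bounded_Phi (q := q) (n := n) (A := A) hmesh B hk).mul (fun _ => zero_le_one)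
    (fun e => hp e _) (bounded_scaledKernel hmesh B.p)
  have h2 := h1.mul (fun e => mul_nonneg zero_le_one (hp e _)) (fun e => hs e _)
    (bounded_Psi hmesh B)
  have h3 := h2.smul (fun e => mul_nonneg (mul_nonneg zero_le_one (hp e _)) (hs e _)) hM
    (bounded_density hmesh)
  have h4 := (bounded_surfaceJacobian (q := q) (n := n) (A := A) hmesh).smul
    (fun e => by positivity)
    (fun e => mul_nonneg (mul_nonneg (mul_nonneg zero_le_one (hp e _)) (hs e _)) (hM e)) h3
  refine h4.congr fun e y _ => ?_
  simp only [integrand, B.regularizedIntegrand_eq Γ k n e.a e.δ_pos]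

theorem deltaExponent_pos (B : LayerOp) (q : ℕ) : 1 ≤ B.deltaExponent q := by
  cases B <;> simp [LayerOp.deltaExponent, LayerOp.p, LayerOp.s]

/-- The factor `ρ⁻³` is kept because its surface integral costs only `1/δ`; the remaining negative
powers are bounded through `δ ≤ ρ`. Hence one power of `δ` fewer than in the final exponent. -/
theorem weight_le {P δ ρ : ℝ} (hP : 1 ≤ P) (hδ : 0 < δ) (hδρ : δ ≤ ρ) (hρ : ρ ≤ P)
    (B : LayerOp) (q : ℕ) :
    (ρ ^ (2 * B.p + 1))⁻¹ * ρ ^ (2 * B.s) * (ρ ^ (q + 1))⁻¹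
      ≤ P * (δ ^ (B.deltaExponent q - 1))⁻¹ * (ρ ^ 3)⁻¹ := by
  have hρ0 : 0 < ρ := hδ.trans_le hδρ
  have key : ∀ m : ℕ, (ρ ^ (m + 3))⁻¹ ≤ P * (δ ^ m)⁻¹ * (ρ ^ 3)⁻¹ := by
    intro m
    rw [pow_add, mul_inv]
    gcongr
    calc (ρ ^ m)⁻¹ ≤ 1 * (δ ^ m)⁻¹ := by rw [one_mul]; gcongr
      _ ≤ _ := by gcongr
  cases B
  -- For the single layer, splitting off `ρ⁻³` and `ρ^{-q}` leaves a surplus factor `ρ`, bounded by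
  -- `P`.
  · have h : (ρ ^ (q + 2))⁻¹ ≤ P * (δ ^ q)⁻¹ * (ρ ^ 3)⁻¹ := by
      calc (ρ ^ (q + 2))⁻¹ = ρ * (ρ ^ q)⁻¹ * (ρ ^ 3)⁻¹ := by field_simp; ring
        _ ≤ _ := by gcongr
    refine Eq.trans_le ?_ h
    simp only [LayerOp.p, LayerOp.s]
    field_simp; ring
  · refine Eq.trans_le ?_ (key (q + 1))
    simp only [LayerOp.p, LayerOp.s]
    field_simp; ring
  · refine Eq.trans_le ?_ (key (q + 1))
    simp only [LayerOp.p, LayerOp.s]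
    field_simp; ring
  · refine Eq.trans_le ?_ (key (q + 1))
    simp only [LayerOp.p, LayerOp.s]
    field_simp; ring
  · refine Eq.trans_le ?_ (key (q + 3))
    simp only [LayerOp.p, LayerOp.s]
    field_simp; ring

/-- The derivative of order `q + 1` of the pulled back integrand. -/
theorem exists_norm_iteratedFDerivWithin_integrand_le (hmesh : ShapeRegular mesh) (B : LayerOp)
    {k : ℝ} (hk : 0 < k) : ∃ C : ℝ, 0 ≤ C ∧ ∀ e : ErrorData mesh q n A,
      ContDiffOn ℝ (q + 1) (integrand B k e) That.carrier ∧
      ‖iteratedFDerivWithin ℝ (q + 1) (integrand B k e) That.carrier e.z‖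
        ≤ C * e.M * e.h ^ (q + 1) * (e.δ ^ (B.deltaExponent q - 1))⁻¹
          * (e.h ^ 2 * (e.dist ^ 3)⁻¹) := by
  obtain ⟨P, hP, hdist⟩ := exists_dist_le Γ
  obtain ⟨C, Λ, hC, hΛ, hb⟩ := bounded_integrand (q := q) (n := n) (A := A) hmesh B hk
  refine ⟨C * Λ ^ (q + 1) * P, by positivity, fun e => ⟨by exact_mod_cast (hb e).1, ?_⟩⟩
  refine ((hb e).2 (q + 1) le_rfl).trans ?_
  have hd := e.dist_pos
  have hh := e.h_pos
  have hM := e.M_nonneg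
  have hδ := e.δ_pos
  change C * (e.h ^ 2 * (1 * (e.dist ^ (2 * B.p + 1))⁻¹ * e.dist ^ (2 * B.s) * e.M))
    * (Λ * (e.h / e.dist)) ^ (q + 1) ≤ _
  calc _ = C * Λ ^ (q + 1) * e.M * e.h ^ (q + 1) * e.h ^ 2 * ((e.dist ^ (2 * B.p + 1))⁻¹
        * e.dist ^ (2 * B.s) * (e.dist ^ (q + 1))⁻¹) := by
        rw [mul_pow, div_pow]; field_simp
    _ ≤ C * Λ ^ (q + 1) * e.M * e.h ^ (q + 1) * e.h ^ 2
        * (P * (e.δ ^ (B.deltaExponent q - 1))⁻¹ * (e.dist ^ 3)⁻¹) := by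
        exact mul_le_mul_of_nonneg_left (weight_le hP hδ e.δ_le_dist (hdist e) B q)
          (by positivity)
    _ = _ := by ring

end ErrorData


/-! ### From the element errors to the discretization error -/

namespace LayerOp

variable (Γ : ClosedSurface) (B : LayerOp)

theorem continuousOn_Psi (x : E3) : ContinuousOn (B.Psi Γ x) Γ.carrier := by
  have hν : ContinuousOn Γ.normal Γ.carrier :=
    Γ.contDiffOn_normal.continuousOn.mono Γ.carrier_subset_regularSet
  have hd : ContinuousOn (fun y : E3 => x - y) Γ.carrier := by fun_prop
  cases B
  · exact continuousOn_const
  · exact hν.inner hd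
  · exact continuousOn_const.inner (continuousOn_id.sub continuousOn_const)
  · exact (hd.inner hd).mul (hν.inner continuousOn_const)
  · exact (hd.inner hν).mul (hd.inner continuousOn_const)

theorem continuousOn_regularizedIntegrand {k : ℝ} (hk : 0 < k) (n : ℕ) (a : ℕ → ℝ) {δ : ℝ}
    (hδ : 0 < δ) {φ : E3 → ℂ} (hφ : ContinuousOn φ Γ.carrier) (x : E3) :
    ContinuousOn (B.regularizedIntegrand Γ k n a δ φ x) Γ.carrier := by
  have h1 : Continuous fun y : E3 => B.Phi (k * ‖y - x‖) :=
    (B.contDiff_Phi_norm hk).continuous.comp (continuous_id.sub continuous_const)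
  have h2 : Continuous fun y : E3 => scaledKernel B.p n a δ (‖y - x‖ ^ 2) :=
    (contDiff_scaledKernel B.p n a δ).continuous.comp (by fun_prop)
  exact (((h1.mul h2).continuousOn.mul (B.continuousOn_Psi Γ x)).smul hφ).congr fun y _ =>
    B.regularizedIntegrand_eq Γ k n a hδ φ x y

theorem regularizedIntegrand_congr (k : ℝ) (n : ℕ) (a : ℕ → ℝ) (δ : ℝ) {φ ψ : E3 → ℂ}
    {s : Set E3} (h : Set.EqOn φ ψ s) (x : E3) :
    Set.EqOn (B.regularizedIntegrand Γ k n a δ φ x) (B.regularizedIntegrand Γ k n a δ ψ x) s :=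
  fun y hy => by rw [regularizedIntegrand, regularizedIntegrand, h hy]

end LayerOp

namespace ErrorData

variable {ι : Type*} {Γ : ClosedSurface} {That : ReferenceElement}
  {mesh : ι → SurfaceMesh Γ That} {q n : ℕ} {A : ℝ}

theorem continuousOn_surfaceJacobian (hmesh : ShapeRegular mesh) (e : ErrorData mesh q n A) :
    ContinuousOn (surfaceJacobian That e.F) That.carrier := by
  obtain ⟨_, _, _, _, hb⟩ := bounded_surfaceJacobian (q := q) (n := n) (A := A) hmesh
  exact (hb e).1.continuousOn

/-- The integral of `(δ + |y - x|)⁻³` over the element. -/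
noncomputable def cubeIntegral (e : ErrorData mesh q n A) : ℝ :=
  ∫ z in That.carrier, surfaceJacobian That e.F z • ((e.δ + ‖e.F z - e.x‖) ^ 3)⁻¹

/-- If `h ≤ δ`, then `ρ` at any point of the element is at most twice `ρ` at the marked point, so a
pointwise value of `ρ⁻³` is dominated by eight times its value everywhere on the element. With `J ≥
c h²` this becomes an integral. -/
theorem exists_sq_mul_inv_cube_le (hmesh : ShapeRegular mesh) : ∃ C : ℝ, 0 ≤ C ∧
    ∀ e : ErrorData mesh q n A, e.h ≤ e.δ → e.h ^ 2 * (e.dist ^ 3)⁻¹ ≤ C * e.cubeIntegral := by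
  obtain ⟨c, hc, hJ⟩ := hmesh.2
  have hV : 0 < volume.real That.carrier := by
    refine ENNReal.toReal_pos (ne_of_gt ?_) That.compact.measure_lt_top.ne
    exact (isOpen_interior.measure_pos volume That.interior_nonempty).trans_le
      (measure_mono interior_subset)
  refine ⟨8 / c * (volume.real That.carrier)⁻¹, by positivity, fun e he => ?_⟩
  have hd := e.dist_pos
  have hδ := e.δ_pos
  have hpt : ∀ z ∈ That.carrier, c / 8 * (e.h ^ 2 * (e.dist ^ 3)⁻¹)
      ≤ surfaceJacobian That e.F z • ((e.δ + ‖e.F z - e.x‖) ^ 3)⁻¹ := by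
    intro z hz
    have hle : e.δ + ‖e.F z - e.x‖ ≤ 2 * e.dist := by
      have h1 : ‖e.F z - e.x‖ ≤ ‖e.F z - e.F e.z‖ + ‖e.F e.z - e.x‖ :=
        norm_sub_le_norm_sub_add_norm_sub _ _ _
      have h2 : ‖e.F z - e.F e.z‖ ≤ e.h := (mesh e.i).norm_sub_le_elementDiam e.T hz e.z_mem
      have h3 := norm_nonneg (e.F e.z - e.x)
      unfold ErrorData.dist
      linarith
    calc c / 8 * (e.h ^ 2 * (e.dist ^ 3)⁻¹) = (c * e.h ^ 2) * ((2 * e.dist) ^ 3)⁻¹ := by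
          rw [mul_pow]; field_simp; ring
      _ ≤ surfaceJacobian That e.F z * ((e.δ + ‖e.F z - e.x‖) ^ 3)⁻¹ := by
          refine mul_le_mul (hJ e.i e.T z hz) ?_ (by positivity) (norm_nonneg _)
          gcongr
  have hint : IntegrableOn (fun z => surfaceJacobian That e.F z •
      ((e.δ + ‖e.F z - e.x‖) ^ 3)⁻¹) That.carrier := by
    refine ContinuousOn.integrableOn_compact That.compact
      ((e.continuousOn_surfaceJacobian hmesh).smul (ContinuousOn.inv₀ ?_ fun z _ => ?_))
    · exact (continuousOn_const.add (e.F_smooth.continuousOn.sub continuousOn_const).norm).pow 3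
    · positivity
  have h := setIntegral_mono_on (integrableOn_const That.compact.measure_lt_top.ne) hint
    That.compact.measurableSet hpt
  rw [setIntegral_const, smul_eq_mul] at h
  change _ ≤ e.cubeIntegral at h
  calc e.h ^ 2 * (e.dist ^ 3)⁻¹ = 8 / c * (volume.real That.carrier)⁻¹
        * (volume.real That.carrier * (c / 8 * (e.h ^ 2 * (e.dist ^ 3)⁻¹))) := by field_simp
    _ ≤ _ := by gcongr

/-- The quadrature error on one element. -/
theorem exists_norm_integral_sub_apply_le (hmesh : ShapeRegular mesh) (Q : QuadratureRule That q)
    (B : LayerOp) {k : ℝ} (hk : 0 < k) : ∃ C : ℝ, 0 ≤ C ∧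
    ∀ e : ErrorData mesh q n A, e.h ≤ e.δ →
      ‖(∫ z in That.carrier, integrand B k e z) - Q.apply (integrand B k e)‖
        ≤ C * e.M * e.h ^ (q + 1) * (e.δ ^ (B.deltaExponent q - 1))⁻¹ * e.cubeIntegral := by
  obtain ⟨C₁, hC₁, h₁⟩ := exists_sq_mul_inv_cube_le (q := q) (n := n) (A := A) hmesh
  obtain ⟨C₂, hC₂, h₂⟩ := exists_norm_iteratedFDerivWithin_integrand_le (q := q) (n := n) (A := A)
    hmesh B hk
  obtain ⟨C₃, hC₃, h₃⟩ := Q.exists_error_le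
  refine ⟨C₃ * C₂ * C₁, by positivity, fun e he => ?_⟩
  have hh := e.h_pos
  have hM := e.M_nonneg
  have hδ := e.δ_pos
  refine (h₃ _ (h₂ e).1 (C₂ * e.M * e.h ^ (q + 1) * (e.δ ^ (B.deltaExponent q - 1))⁻¹
    * (C₁ * e.cubeIntegral)) fun z hz => ?_).trans_eq (by ring)
  -- Neither the integrand nor `cubeIntegral` depends on the marked point; moving it turns the
  -- pointwise estimate into a supremum over the element.
  refine (h₂ { e with z := z, z_mem := hz }).2.trans ?_
  exact mul_le_mul_of_nonneg_left (h₁ { e with z := z, z_mem := hz } he) (by positivity)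

end ErrorData

theorem QuadratureRule.compositeQuadrature_eq {Γ : ClosedSurface} {That : ReferenceElement} {q : ℕ}
    (Q : QuadratureRule That q) (M : SurfaceMesh Γ That) (ψ : E3 → ℂ) :
    compositeQuadrature Q M ψ
      = ∑ T, Q.apply fun z => surfaceJacobian That (M.param T) z • ψ (M.param T z) := by
  unfold compositeQuadrature QuadratureRule.apply
  refine Finset.sum_congr rfl fun T _ => Finset.sum_congr rfl fun j _ => ?_
  simp only [Complex.real_smul, Complex.ofReal_mul, mul_assoc]

theorem ShapeRegular.surfaceJacobian_pos {ι : Type*} {Γ : ClosedSurface} {That : ReferenceElement}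
    {mesh : ι → SurfaceMesh Γ That} (hmesh : ShapeRegular mesh) (i : ι) (T : Fin (mesh i).card)
    (z : E2) (hz : z ∈ That.carrier) : 0 < surfaceJacobian That ((mesh i).param T) z := by
  obtain ⟨c, hc, hJ⟩ := hmesh.2
  have := (mesh i).elementDiam_pos T
  exact (by positivity : 0 < c * (mesh i).elementDiam T ^ 2).trans_le (hJ i T z hz)

section DiscretizationError

variable {ι : Type*} {Γ : ClosedSurface} {That : ReferenceElement}
  {mesh : ι → SurfaceMesh Γ That} {q : ℕ}

theorem discretizationError_congr (Q : QuadratureRule That q) (M : SurfaceMesh Γ That)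
    (B : LayerOp) (k : ℝ) (n : ℕ) (a : ℕ → ℝ) (δ : ℝ) {φ ψ : E3 → ℂ}
    (h : Set.EqOn φ ψ Γ.carrier) (x : E3) :
    discretizationError Q M B k n a δ φ x = discretizationError Q M B k n a δ ψ x := by
  have h' := B.regularizedIntegrand_congr Γ k n a δ h x
  unfold discretizationError compositeQuadrature
  congr 1
  · refine integral_congr_ae ?_
    filter_upwards [Γ.ae_mem_carrier] with y hy using h' hy
  · refine Finset.sum_congr rfl fun T _ => Finset.sum_congr rfl fun j _ => ?_
    rw [h' (M.mapsTo_param T (Q.node_mem j))]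

/-- The discretization error for a density that extends smoothly to `ℝ³`. -/
theorem exists_norm_discretizationError_le_of_contDiff (hmesh : ShapeRegular mesh)
    (Q : QuadratureRule That q) (B : LayerOp) {k : ℝ} (hk : 0 < k) (n : ℕ) (A : ℝ) :
    ∃ C : ℝ, 0 < C ∧ ∀ a : ℕ → ℝ, (∀ ℓ ∈ Finset.Icc 1 n, |a ℓ| ≤ A) →
      ∀ g : E3 → ℂ, ContDiff ℝ (q + 1 : ℕ) g → ∀ M : ℝ, 0 ≤ M →
      (∀ j ≤ q + 1, ∀ y ∈ Γ.carrier, ‖iteratedFDeriv ℝ j g y‖ ≤ M) →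
      ∀ x ∈ Γ.carrier, ∀ δ : ℝ, 0 < δ → δ < 1 → ∀ i : ι, (mesh i).size ≤ δ →
        ‖discretizationError Q (mesh i) B k n a δ g x‖
          ≤ C * M * (mesh i).size ^ (q + 1) * (δ ^ B.deltaExponent q)⁻¹ := by
  obtain ⟨C₁, hC₁, h₁⟩ := ErrorData.exists_norm_integral_sub_apply_le (n := n) (A := A) hmesh Q B hk
  obtain ⟨C₂, hC₂, h₂⟩ := Γ.exists_integral_inv_cube_le
  refine ⟨(C₁ + 1) * C₂, by positivity, fun a ha g hg M hM hgM x hx δ hδ hδ1 i hi => ?_⟩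
  obtain ⟨z₀, hz₀⟩ := That.interior_nonempty
  let e : Fin (mesh i).card → ErrorData mesh q n A := fun T =>
    ⟨i, T, x, hx, δ, hδ, hδ1, a, ha, g, hg, M, hM, hgM, z₀, interior_subset hz₀⟩
  have hJ := hmesh.surfaceJacobian_pos i
  have hint := Γ.integrable_of_continuousOn
    (B.continuousOn_regularizedIntegrand Γ hk n a hδ hg.continuous.continuousOn x)
  have hcube : Integrable (fun y : E3 => ((δ + ‖y - x‖) ^ 3)⁻¹) Γ.area := by
    refine Γ.integrable_of_continuousOn (Continuous.continuousOn ?_)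
    exact Continuous.inv₀ (by fun_prop) fun y => by positivity
  -- Mesh additivity makes the total independent of the number of elements.
  have hsum : ∑ T, (e T).cubeIntegral = ∫ y, ((δ + ‖y - x‖) ^ 3)⁻¹ ∂Γ.area :=
    ((mesh i).integral_area hJ hcube).symm
  have herr : discretizationError Q (mesh i) B k n a δ g x
      = ∑ T, ((∫ z in That.carrier, (e T).integrand B k z) - Q.apply ((e T).integrand B k)) := by
    rw [discretizationError, Q.compositeQuadrature_eq, (mesh i).integral_area hJ hint,
      ← Finset.sum_sub_distrib]
    rfl
  have hnonneg : ∀ T, 0 ≤ (e T).cubeIntegral := fun T =>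
    setIntegral_nonneg That.compact.measurableSet fun z _ =>
      mul_nonneg (norm_nonneg _) (by change 0 ≤ ((δ + ‖(e T).F z - x‖) ^ 3)⁻¹; positivity)
  have hsize : 0 ≤ (mesh i).size := Real.iSup_nonneg fun T => Metric.diam_nonneg
  have hle : ∀ T, ‖(∫ z in That.carrier, (e T).integrand B k z) - Q.apply ((e T).integrand B k)‖
      ≤ (C₁ + 1) * M * (mesh i).size ^ (q + 1) * (δ ^ (B.deltaExponent q - 1))⁻¹
        * (e T).cubeIntegral := by
    intro T
    have hT := (mesh i).elementDiam_le_size T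
    have h0 := ((mesh i).elementDiam_pos T).le
    refine (h₁ (e T) (hT.trans hi)).trans (mul_le_mul_of_nonneg_right ?_ (hnonneg T))
    change C₁ * M * (mesh i).elementDiam T ^ (q + 1) * (δ ^ (B.deltaExponent q - 1))⁻¹ ≤ _
    gcongr
    linarith
  rw [herr]
  refine (norm_sum_le_of_le _ fun T _ => hle T).trans ?_
  rw [← Finset.mul_sum, hsum]
  calc _ ≤ (C₁ + 1) * M * (mesh i).size ^ (q + 1) * (δ ^ (B.deltaExponent q - 1))⁻¹
        * (C₂ / δ) := by
        have := h₂ x hx δ hδ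
        gcongr
    _ = (C₁ + 1) * C₂ * M * (mesh i).size ^ (q + 1)
        * (δ ^ (B.deltaExponent q - 1 + 1))⁻¹ := by
        rw [pow_succ δ, mul_inv]; ring
    _ = _ := by rw [Nat.sub_add_cancel (ErrorData.deltaExponent_pos B q)]

end DiscretizationError

/-- A bound valid for every extension passes to the infimum, whether or not it is attained.
Compactness of `Γ` makes the set of admissible constants non-empty. -/
theorem ClosedSurface.le_mul_ckNorm {Γ : ClosedSurface} {r : ℕ} {φ : E3 → ℂ} (hφ : Γ.IsCk r φ)
    {t Y : ℝ} (hY : 0 ≤ Y)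
    (h : ∀ g : E3 → ℂ, ContDiff ℝ r g → Set.EqOn g φ Γ.carrier → ∀ M : ℝ, 0 ≤ M →
      (∀ j ≤ r, ∀ y ∈ Γ.carrier, ‖iteratedFDeriv ℝ j g y‖ ≤ M) → t ≤ M * Y) :
    t ≤ Γ.ckNorm r φ * Y := by
  have hne : {M : ℝ | 0 ≤ M ∧ ∃ g : E3 → ℂ, ContDiff ℝ r g ∧ Set.EqOn g φ Γ.carrier ∧
      ∀ j ≤ r, ∀ y ∈ Γ.carrier, ‖iteratedFDeriv ℝ j g y‖ ≤ M}.Nonempty := by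
    obtain ⟨g, hg, hgφ⟩ := hφ
    have hb : ∀ j, ∃ K : ℝ, j ≤ r → ∀ y ∈ Γ.carrier, ‖iteratedFDeriv ℝ j g y‖ ≤ K := by
      intro j
      by_cases hj : j ≤ r
      · obtain ⟨K, hK⟩ := Γ.isCompact_carrier.exists_bound_of_continuousOn
          (hg.continuous_iteratedFDeriv (m := j) (by exact_mod_cast hj)).continuousOn
        exact ⟨K, fun _ => hK⟩
      · exact ⟨0, fun h => absurd h hj⟩
    choose K hK using hb
    refine ⟨∑ j ∈ Finset.range (r + 1), |K j|, Finset.sum_nonneg fun _ _ => abs_nonneg _, g, hg,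
      hgφ, fun j hj y hy => (hK j hj y hy).trans ((le_abs_self _).trans ?_)⟩
    exact Finset.single_le_sum (f := fun j => |K j|) (fun _ _ => abs_nonneg _)
      (Finset.mem_range.2 (Nat.lt_succ_of_le hj))
  -- Division by `Y` needs `Y > 0`; for `Y = 0` any one extension gives `t ≤ 0`.
  rcases hY.eq_or_lt with rfl | hY
  · obtain ⟨M, hM, g, hg, hgφ, hle⟩ := hne
    simpa using h g hg hgφ M hM hle
  · rw [← div_le_iff₀ hY]
    refine le_csInf hne ?_
    rintro M ⟨hM, g, hg, hgφ, hle⟩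
    rw [div_le_iff₀ hY]
    exact h g hg hgφ M hM hle

theorem LayerOp.inv_pow_deltaExponent (B : LayerOp) (q : ℕ) (δ : ℝ) :
    (δ ^ B.deltaExponent q)⁻¹ = if B.p = B.s then δ ^ (-((q : ℤ) + 1))
      else δ ^ (-((q : ℤ) + 2 * ((B.p : ℤ) - B.s))) := by
  have h : (δ ^ B.deltaExponent q)⁻¹ = δ ^ (-(B.deltaExponent q : ℤ)) := by
    rw [zpow_neg, zpow_natCast]
  rw [h]
  cases B <;> simp [deltaExponent, p, s]

/-- The discretization error bound. -/
theorem exists_norm_discretizationError_le {ι : Type*} {Γ : ClosedSurface}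
    {That : ReferenceElement} {mesh : ι → SurfaceMesh Γ That} {q : ℕ} (hmesh : ShapeRegular mesh)
    (Q : QuadratureRule That q) (B : LayerOp) {k : ℝ} (hk : 0 < k) (n : ℕ) (A : ℝ) :
    ∃ C : ℝ, 0 < C ∧ ∀ a : ℕ → ℝ, (∀ ℓ ∈ Finset.Icc 1 n, |a ℓ| ≤ A) →
      ∀ φ : E3 → ℂ, Γ.IsCk (q + 1) φ → ∀ x ∈ Γ.carrier, ∀ δ : ℝ, 0 < δ → δ < 1 →
      ∀ i : ι, (mesh i).size ≤ δ →
        ‖discretizationError Q (mesh i) B k n a δ φ x‖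
          ≤ C * Γ.ckNorm (q + 1) φ * (mesh i).size ^ (q + 1) * (δ ^ B.deltaExponent q)⁻¹ := by
  obtain ⟨C, hC, h⟩ := exists_norm_discretizationError_le_of_contDiff hmesh Q B hk n A
  refine ⟨C, hC, fun a ha φ hφ x hx δ hδ hδ1 i hi => ?_⟩
  have hsize : 0 ≤ (mesh i).size := Real.iSup_nonneg fun T => Metric.diam_nonneg
  refine (ClosedSurface.le_mul_ckNorm hφ
    (Y := C * (mesh i).size ^ (q + 1) * (δ ^ B.deltaExponent q)⁻¹) (by positivity)
    fun g hg hgφ M hM hle => ?_).trans_eq (by ring)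
  rw [← discretizationError_congr Q (mesh i) B k n a δ hgφ x]
  exact (h a ha g hg M hM hle x hx δ hδ hδ1 i hi).trans_eq (by ring)


/-! ### Exponents and the optimal regularization parameter -/

namespace LayerOp

variable (B : LayerOp)

/-- Here `d` is 1, 2, 2, 2, 4 for the five operators. The form `q + d` with `d ≥ 1` is all that the
rates need, so the case split happens only once. -/
theorem exists_deltaExponent_eq : ∃ d : ℕ, 1 ≤ d ∧ ∀ q, B.deltaExponent q = q + d := by
  cases B
  exacts [⟨1, le_rfl, fun _ => rfl⟩, ⟨2, by norm_num, fun _ => rfl⟩, ⟨2, by norm_num, fun _ => rfl⟩,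
    ⟨2, by norm_num, fun _ => rfl⟩, ⟨4, by norm_num, fun _ => rfl⟩]

theorem muStar_eq (q m : ℕ) :
    B.muStar q m = ((q : ℝ) + 1) / (B.deltaExponent q + m) := by
  cases B <;> simp [muStar, deltaExponent, p, s] <;> norm_num

theorem muStar_pos (q m : ℕ) : 0 < B.muStar q m := by
  obtain ⟨d, hd, h⟩ := B.exists_deltaExponent_eq
  rw [muStar_eq, h]
  positivity

/-- Ensures that `δ = c h^{μ⋆}` eventually exceeds `h`, as the error bound requires. It needs `m ≥
1`: for `d = 1` and `m = 0` the exponent equals 1. -/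
theorem muStar_lt_one (q : ℕ) {m : ℕ} (hm : 1 ≤ m) : B.muStar q m < 1 := by
  obtain ⟨d, hd, h⟩ := B.exists_deltaExponent_eq
  rw [muStar_eq, h, div_lt_one (by positivity)]
  have : (1 : ℝ) ≤ d := by exact_mod_cast hd
  have : (1 : ℝ) ≤ m := by exact_mod_cast hm
  push_cast
  linarith

/-- The balance equation `μ⋆ (e + m) = q + 1`, rearranged. -/
theorem oStar_eq_sub (q m : ℕ) :
    B.oStar q m = ((q : ℝ) + 1) - B.deltaExponent q * B.muStar q m := by
  obtain ⟨d, hd, h⟩ := B.exists_deltaExponent_eq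
  have : (0 : ℝ) < (q + d : ℕ) + m := by positivity
  rw [oStar, muStar_eq, h]
  field_simp
  ring

theorem tendsto_oStar_atTop_left (q : ℕ) :
    Tendsto (fun m : ℕ => B.oStar q m) atTop (𝓝 ((q : ℝ) + 1)) := by
  have h : Tendsto (fun m : ℕ => ((q : ℝ) + 1) - B.deltaExponent q
      * (((q : ℝ) + 1) / (B.deltaExponent q + m))) atTop
      (𝓝 (((q : ℝ) + 1) - B.deltaExponent q * 0)) :=
    (((tendsto_const_nhds.div_atTop (tendsto_atTop_add_const_left _ _
      tendsto_natCast_atTop_atTop)).const_mul _).const_sub _)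
  simpa only [← muStar_eq, ← oStar_eq_sub, mul_zero, sub_zero] using h

theorem tendsto_oStar_atTop_right (m : ℕ) :
    Tendsto (fun r : ℕ => B.oStar r m) atTop (𝓝 (m : ℝ)) := by
  obtain ⟨d, hd, he⟩ := B.exists_deltaExponent_eq
  -- The rate is written as its limit `m` minus a remainder with numerator independent of the
  -- degree.
  have h : Tendsto (fun r : ℕ => (m : ℝ) - (m * (d - 1 + m) : ℝ) / (r + (d + m) : ℝ)) atTop
      (𝓝 ((m : ℝ) - 0)) :=
    (tendsto_const_nhds.div_atTop (tendsto_atTop_add_const_right _ _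
      tendsto_natCast_atTop_atTop)).const_sub _
  rw [sub_zero] at h
  refine h.congr fun r => ?_
  rw [oStar, muStar_eq, he]
  push_cast
  have : (0 : ℝ) < r + d + m := by positivity
  have : (0 : ℝ) < r + (d + m) := by positivity
  field_simp
  ring

end LayerOp

section OptimalParameter

variable {ι : Type*} {h δ : ι → ℝ} {c μ : ℝ}

theorem tendsto_const_mul_rpow_nhdsGT_zero (hc : 0 < c) (hμ : 0 < μ)
    (hδ : ∀ i, δ i = c * h i ^ μ) : Tendsto δ (comap h (𝓝[>] 0)) (𝓝[>] 0) := by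
  have h1 : Tendsto (fun t : ℝ => c * t ^ μ) (𝓝[>] 0) (𝓝[>] 0) := by
    refine tendsto_nhdsWithin_iff.2 ⟨?_, ?_⟩
    · have := ((Real.continuousAt_rpow_const 0 μ (Or.inr hμ.le)).tendsto.const_mul c)
      rw [Real.zero_rpow hμ.ne', mul_zero] at this
      exact this.mono_left nhdsWithin_le_nhds
    · filter_upwards [self_mem_nhdsWithin] with t ht
      exact mul_pos hc (Real.rpow_pos_of_pos ht μ)
  exact (h1.comp tendsto_comap).congr fun i => (hδ i).symm

theorem eventually_comap_nhdsGT_zero_pos : ∀ᶠ i in comap h (𝓝[>] 0), 0 < h i :=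
  tendsto_comap.eventually self_mem_nhdsWithin

/-- Since `h = h^{1-μ} h^μ` and `h^{1-μ} → 0`, the first factor eventually drops below `c`. -/
theorem eventually_le_const_mul_rpow (hc : 0 < c) (hμ : μ < 1) :
    ∀ᶠ i in comap h (𝓝[>] 0), h i ≤ c * h i ^ μ := by
  have h1 : Tendsto (fun t : ℝ => t ^ (1 - μ)) (𝓝[>] 0) (𝓝 0) := by
    have := (Real.continuousAt_rpow_const 0 (1 - μ) (Or.inr (by linarith))).tendsto
    rw [Real.zero_rpow (by linarith)] at this
    exact this.mono_left nhdsWithin_le_nhds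
  refine tendsto_comap.eventually (p := fun t : ℝ => t ≤ c * t ^ μ) ?_
  filter_upwards [h1.eventually_le_const hc, self_mem_nhdsWithin] with t ht ht0
  have ht0' : (0 : ℝ) < t := ht0
  calc t = t ^ (1 - μ) * t ^ μ := by rw [← Real.rpow_add ht0']; simp
    _ ≤ c * t ^ μ := by gcongr

theorem const_mul_rpow_pow (hδ : ∀ i, δ i = c * h i ^ μ) {i : ι} (hi : 0 < h i) (m : ℕ) :
    δ i ^ m = c ^ m * h i ^ (μ * m) := by
  rw [hδ, mul_pow, Real.rpow_mul_natCast hi.le]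

end OptimalParameter

end KernelReg

theorem mainTheorem1 {ι : Type*} (Γ : ClosedSurface) (That : ReferenceElement)
    (mesh : ι → SurfaceMesh Γ That) (hmesh : ShapeRegular mesh)
    (q : ℕ) (Q : QuadratureRule That q)
    (B : LayerOp) (k : ℝ) (hk : 0 < k) (n : ℕ) (A : ℝ) :
    -- discretization error bound
    (∃ C : ℝ, 0 < C ∧
      ∀ a : ℕ → ℝ, (∀ ℓ ∈ Finset.Icc 1 n, |a ℓ| ≤ A) →
      ∀ φ : E3 → ℂ, Γ.IsCk (q + 1) φ → ∀ x ∈ Γ.carrier,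
      ∀ δ : ℝ, 0 < δ → δ < 1 →
        Integrable (B.regularizedIntegrand Γ k n a δ φ x) Γ.area ∧
        ∀ i : ι, (mesh i).size ≤ δ →
          ‖discretizationError Q (mesh i) B k n a δ φ x‖
            ≤ C * Γ.ckNorm (q + 1) φ * (mesh i).size ^ (q + 1)
              * (if B.p = B.s then δ ^ (-((q : ℤ) + 1))
                else δ ^ (-((q : ℤ) + 2 * ((B.p : ℤ) - B.s))))) ∧
    -- optimal regularization parameter
    (∀ m : ℕ, 1 ≤ m →
      ∀ a : ℝ → ℕ → ℝ, (∀ δ : ℝ, 0 < δ → δ < 1 → ∀ ℓ ∈ Finset.Icc 1 n, |a δ ℓ| ≤ A) →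
      ∀ φ : E3 → ℂ, Γ.IsCk (q + 1) φ → ∀ x ∈ Γ.carrier,
      ∀ L : ℂ, Γ.HasFinitePart x (B.singularIntegrand Γ k φ x) L →
      (fun δ : ℝ => regularizationError Γ B k n (a δ) δ φ x L) =O[𝓝[>] 0]
        (fun δ : ℝ => δ ^ m) →
      ∀ c : ℝ, 0 < c → ∀ δ : ι → ℝ, (∀ i, δ i = c * (mesh i).size ^ B.muStar q m) →
        ((fun i => regularizationError Γ B k n (a (δ i)) (δ i) φ x L)
            =O[comap (fun i => (mesh i).size) (𝓝[>] 0)]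
          (fun i => (mesh i).size ^ B.oStar q m)) ∧
        ((fun i => discretizationError Q (mesh i) B k n (a (δ i)) (δ i) φ x)
            =O[comap (fun i => (mesh i).size) (𝓝[>] 0)]
          (fun i => (mesh i).size ^ B.oStar q m)) ∧
        ((fun i => regularizationError Γ B k n (a (δ i)) (δ i) φ x L
              + discretizationError Q (mesh i) B k n (a (δ i)) (δ i) φ x)
            =O[comap (fun i => (mesh i).size) (𝓝[>] 0)]
          (fun i => (mesh i).size ^ B.oStar q m))) ∧
    -- the rate equates the two error orders, and its limiting values
    (∀ m : ℕ, 1 ≤ m →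
      B.oStar q m = B.muStar q m * m ∧
      B.oStar q m = ((q : ℝ) + 1) - B.deltaExponent q * B.muStar q m) ∧
    Tendsto (fun m : ℕ => B.oStar q m) atTop (𝓝 ((q : ℝ) + 1)) ∧
    (∀ m : ℕ, Tendsto (fun r : ℕ => B.oStar r m) atTop (𝓝 (m : ℝ))) := by
  obtain ⟨C, hC, hbound⟩ := exists_norm_discretizationError_le hmesh Q B hk n A
  refine ⟨⟨C, hC, fun a ha φ hφ x hx δ hδ hδ1 => ⟨?_, fun i hi => ?_⟩⟩, ?_,
    fun m _ => ⟨rfl, B.oStar_eq_sub q m⟩, B.tendsto_oStar_atTop_left q, B.tendsto_oStar_atTop_right⟩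
  · obtain ⟨g, hg, hgφ⟩ := hφ
    exact Γ.integrable_of_continuousOn (B.continuousOn_regularizedIntegrand Γ hk n a hδ
      (hg.continuous.continuousOn.congr hgφ.symm) x)
  · rw [← B.inv_pow_deltaExponent q δ]
    exact hbound a ha φ hφ x hx δ hδ hδ1 i hi
  · intro m hm a ha φ hφ x hx L _ hreg c hc δ hδ
    have hδ0 := tendsto_const_mul_rpow_nhdsGT_zero hc (B.muStar_pos q m) hδ
    have hr : (fun i => regularizationError Γ B k n (a (δ i)) (δ i) φ x L)
        =O[comap (fun i => (mesh i).size) (𝓝[>] 0)] (fun i => (mesh i).size ^ B.oStar q m) := by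
      -- Here `δ^m = c^m h^{μ⋆ m}`, so the constant is `c^m`.
      refine (hreg.comp_tendsto hδ0).trans (Asymptotics.IsBigO.of_bound (c ^ m) ?_)
      filter_upwards [eventually_comap_nhdsGT_zero_pos] with i hi
      have := Real.rpow_pos_of_pos hi (B.oStar q m)
      rw [Function.comp_apply, const_mul_rpow_pow hδ hi, ← LayerOp.oStar,
        Real.norm_of_nonneg this.le, Real.norm_of_nonneg (by positivity)]
    have hd : (fun i => discretizationError Q (mesh i) B k n (a (δ i)) (δ i) φ x)
        =O[comap (fun i => (mesh i).size) (𝓝[>] 0)] (fun i => (mesh i).size ^ B.oStar q m) := by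
      -- Substituting `δ = c h^{μ⋆}` turns `h^{q+1} δ^{-e}` into `c^{-e} h^{q+1-eμ⋆}`, whose
      -- exponent is `o⋆` by the balance equation.
      refine Asymptotics.IsBigO.of_bound
        (C * Γ.ckNorm (q + 1) φ * (c ^ B.deltaExponent q)⁻¹) ?_
      filter_upwards [eventually_comap_nhdsGT_zero_pos,
        eventually_le_const_mul_rpow hc (B.muStar_lt_one q hm),
        hδ0.eventually (Ioo_mem_nhdsGT zero_lt_one)] with i hi hle hδi
      rw [← hδ] at hle
      refine (hbound (a (δ i)) (ha _ hδi.1 hδi.2) φ hφ x hx (δ i) hδi.1 hδi.2 i hle).trans_eq ?_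
      have := Real.rpow_pos_of_pos hi (B.oStar q m)
      rw [Real.norm_of_nonneg this.le, const_mul_rpow_pow hδ hi, B.oStar_eq_sub,
        Real.rpow_sub hi, mul_comm (B.deltaExponent q : ℝ), ← Nat.cast_add_one, Real.rpow_natCast]
      field_simp
    exact ⟨hr, hd, hr.add hd⟩
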